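/- Let $M$ be a smooth finite-dimensional manifold (Hausdorff, second countable, without boundary) with a pseudo-Riemannian metric $\eta$ and Levi-Civita connection $\nabla$, let $b\in\Omega^2(M)$ and $H\in\Omega^3(M)$. Write $\eta^\flat(X)=\eta(X,\cdot)$, $b^\flat(X)=b(X,\cdot)$, $\eta^\sharp=(\eta^\flat)^{-1}$. A *metric algebroid* over $M$ is a smooth vector bundle $A\to M$ with an $\mathbb R$-bilinear bracket $[\![\cdot,\cdot]\!]$ on $\Gamma(A)$, a bundle morphism $\rho:A\to TM$ and a fibrewise non-degenerate symmetric smooth pairing $\langle\cdot,\cdot\rangle$ such that, for $f\in C^\infty(M)$ and $e,e_1,e_2\in\Gamma(A)$, $$[\![e_1,f e_2]\!]=f[\![e_1,e_2]\!]+(\rho(e_1)f)\,e_2,\qquad \rho(e)\langle e_1,e_2\rangle=\langle[\![e,e_1]\!],e_2\rangle+\langle e_1,[\![e,e_2]\!]\rangle,\qquad \langle[\![e,e]\!],e_1\rangle=\tfrac12\rho(e_1)\langle e,e\rangle .$$ An *isomorphism* of metric algebroids over $M$ is a vector bundle isomorphism over $\mathrm{id}_M$ that intertwines anchors and brackets and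 is an isometry. Let $\mathbb TM=TM\oplus T^*M$ carry the pairing $\langle X+\alpha,Y+\beta\rangle=\beta(X)+\alpha(Y)$, the anchor $X+\alpha\mapsto X$ and the $H$-twisted Dorfman bracket $$[X+\alpha,Y+\beta]_D=[X,Y]+\mathcal L_X\beta-\iota_Y d\alpha+H(X,Y,\cdot).$$ Let $I_{B_+}=e^{B_+}\circ I_0\circ e^{-B_+}$ with $I_0(X+\alpha)=\eta^\sharp\alpha+\eta^\flat X$ and $B_+(X+\alpha)=b^\flat X$, let $C_\pm\subset\mathbb TM$ be its eigenbundles for the eigenvalues $\pm1$, $p_\pm$ the projection of $\mathbb TM=C_+\oplus C_-$ onto $C_\pm$, and define on $C_\pm$ $$[\![\xi,\xi']\!]^\pm=p_\pm[\xi,\xi']_D,\qquad \langle\xi,\xi'\rangle_{C_\pm}=\pm\tfrac12\langle\xi,\xi'\rangle,\qquad \rho_\pm(X+\alpha)=X .$$ For a $3$-form $T$ define a bracket on $\Gamma(TM)$, the D-bracket of $\eta$ twisted by $T$ (normalized with a factor $\tfrac12$), by $$\eta([\![X,Y]\!]^{\eta,T},Z)=\eta(\nabla_XY-\nabla_YX,Z)+\eta(\nabla_ZX,Y)+\tfrac12\,T(X,Y,Z).$$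 Then, for each choice of sign: $C_\pm=\mathrm{Graph}(b\pm\eta)=\{X+b^\flat X\pm\eta^\flat X\}$; $(C_\pm,[\![\cdot,\cdot]\!]^\pm,\langle\cdot,\cdot\rangle_{C_\pm},\rho_\pm)$ and $(TM,[\![\cdot,\cdot]\!]^{\eta,\pm(H+db)},\eta,\mathrm{id}_{TM})$ are metric algebroids over $M$; and the anchor $\rho_\pm:C_\pm\to TM$ is an isomorphism of metric algebroids from the first to the second. In particular $$\langle[\![\rho_\pm^{-1}X,\rho_\pm^{-1}Y]\!]^\pm,\rho_\pm^{-1}Z\rangle_{C_\pm}=\eta([\![X,Y]\!]^{\eta,0},Z)\pm\tfrac12(H+db)(X,Y,Z).$$ -/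

import Mathlib

open Bundle Manifold VectorField FiberBundle
open scoped ContDiff Topology

namespace DoubledGeometry

noncomputable section

variable {E : Type*} [NormedAddCommGroup E] [NormedSpace ℝ E]
  {B : Type*} [TopologicalSpace B] {I : ModelWithCorners ℝ E B}
  {M : Type*} [TopologicalSpace M] [ChartedSpace B M]

/-! ### Covariant tensors and their derivatives -/

/-- The cotangent space `T*_x M`. -/
abbrev Cotangent (I : ModelWithCorners ℝ E B) (x : M) : Type _ := TangentSpace I x →L[ℝ] ℝ

/-- Bilinear forms on the tangent space `T_x M`. -/
abbrev Tensor2 (I : ModelWithCorners ℝ E B) (x : M) : Type _ :=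
  TangentSpace I x →L[ℝ] TangentSpace I x →L[ℝ] ℝ

/-- Trilinear forms on the tangent space `T_x M`. -/
abbrev Tensor3 (I : ModelWithCorners ℝ E B) (x : M) : Type _ := TangentSpace I x →ₗ[ℝ] Tensor2 I x

instance instContinuousAddCotangent (x : M) : ContinuousAdd (TangentSpace I x →L[ℝ] ℝ) :=
  inferInstanceAs (ContinuousAdd (E →L[ℝ] ℝ))

/-- The invariant formula `X (α Y) - Y (α X) - α [X, Y]` for `dα (X, Y)`, at the point `x`. -/
def dOneFormFun (α : Π x : M, Cotangent I x) (X Y : Π x : M, TangentSpace I x) (x : M) : ℝ :=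
  mvfderiv I (fun y ↦ α y (Y y)) x (X x) - mvfderiv I (fun y ↦ α y (X y)) x (Y x)
    - α x (mlieBracket I X Y x)

/-- The invariant formula `X (b (Y, Z)) + Y (b (Z, X)) + Z (b (X, Y)) - b ([X, Y], Z)
- b ([Y, Z], X) - b ([Z, X], Y)` for `db (X, Y, Z)`, at the point `x`. -/
def dTwoFormFun (b : Π x : M, Tensor2 I x) (X Y Z : Π x : M, TangentSpace I x) (x : M) : ℝ :=
  mvfderiv I (fun y ↦ b y (Y y) (Z y)) x (X x) + mvfderiv I (fun y ↦ b y (Z y) (X y)) x (Y x)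
    + mvfderiv I (fun y ↦ b y (X y) (Y y)) x (Z x) - b x (mlieBracket I X Y x) (Z x)
    - b x (mlieBracket I Y Z x) (X x) - b x (mlieBracket I Z X x) (Y x)

theorem alternating_swap {x : M} {g : Tensor2 I x} (hg : ∀ v, g v v = 0) (u v : TangentSpace I x) :
    g u v = - g v u := by
  have := hg (u + v)
  simp [hg] at this
  linarith

theorem dOneFormFun_swap (α : Π x : M, Cotangent I x) (X Y : Π x : M, TangentSpace I x) (x : M) :
    dOneFormFun α X Y x = - dOneFormFun α Y X x := by
  rw [dOneFormFun, dOneFormFun, mlieBracket_swap_apply]; simp; ring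

theorem dTwoFormFun_cyclic (b : Π x : M, Tensor2 I x) (X Y Z : Π x : M, TangentSpace I x) (x : M) :
    dTwoFormFun b X Y Z x = dTwoFormFun b Y Z X x := by
  rw [dTwoFormFun, dTwoFormFun]; ring

/-- Smoothness of a section of a vector bundle. -/
def IsSmoothSection (I : ModelWithCorners ℝ E B) (F : Type*) [NormedAddCommGroup F]
    [NormedSpace ℝ F] {V : M → Type*} [TopologicalSpace (TotalSpace F V)]
    [∀ x, TopologicalSpace (V x)] [FiberBundle F V] (s : Π x, V x) : Prop :=
  ContMDiff I (I.prod 𝓘(ℝ, F)) ∞ (fun x ↦ TotalSpace.mk' F x (s x))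

variable [IsManifold I ∞ M]

/-- Differentiability at a point of a covector field (a section of `T*M`). -/
abbrev DiffCovectorAt (α : Π x : M, Cotangent I x) (x : M) : Prop :=
  MDifferentiableAt I (I.prod 𝓘(ℝ, E →L[ℝ] ℝ)) (fun y ↦ TotalSpace.mk' (E →L[ℝ] ℝ) y (α y)) x

/-- A field of bilinear forms on the tangent spaces is smooth as a section of the bundle
`Hom(TM, Hom(TM, ℝ))`. -/
abbrev SmoothTensor2 (g : Π x : M, TangentSpace I x →L[ℝ] TangentSpace I x →L[ℝ] ℝ) : Prop :=
  ContMDiff I (I.prod 𝓘(ℝ, E →L[ℝ] E →L[ℝ] ℝ)) ∞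
    (fun y ↦ TotalSpace.mk' (E →L[ℝ] E →L[ℝ] ℝ) y (g y))

theorem mdifferentiableAt_tensor2 {g : Π x : M, Tensor2 I x} (hg : SmoothTensor2 g)
    {X Y : Π x : M, TangentSpace I x} {x : M}
    (hX : MDiffAt (T% X) x) (hY : MDiffAt (T% Y) x) :
    MDiffAt (fun y ↦ g y (X y) (Y y)) x := by
  have : MDifferentiableAt I (I.prod 𝓘(ℝ))
      (fun m ↦ TotalSpace.mk' ℝ (E := Bundle.Trivial M ℝ) m (g m (X m) (Y m))) x := by
    apply MDifferentiableAt.clm_bundle_apply₂ (F₁ := E) (F₂ := E)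
    · exact hg.mdifferentiableAt (by simp)
    · exact hX
    · exact hY
  simp only [mdifferentiableAt_totalSpace] at this
  exact this.2

theorem mdifferentiableAt_covector {α : Π x : M, Cotangent I x} {x : M} (hα : DiffCovectorAt α x)
    {X : Π x : M, TangentSpace I x} (hX : MDiffAt (T% X) x) :
    MDiffAt (fun y ↦ α y (X y)) x := by
  have : MDifferentiableAt I (I.prod 𝓘(ℝ))
      (fun m ↦ TotalSpace.mk' ℝ (E := Bundle.Trivial M ℝ) m (α m (X m))) x := by
    apply MDifferentiableAt.clm_bundle_apply (F₁ := E)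
    · exact hα
    · exact hX
  simp only [mdifferentiableAt_totalSpace] at this
  exact this.2

theorem mvfderiv_tensor2_smul {g : Π x : M, Tensor2 I x} (hg : SmoothTensor2 g)
    {X Y : Π x : M, TangentSpace I x} {f : M → ℝ} {x : M} (hf : MDiffAt f x)
    (hX : MDiffAt (T% X) x) (hY : MDiffAt (T% Y) x) :
    mvfderiv I (fun y ↦ g y (X y) ((f • Y) y)) x =
      f x • mvfderiv I (fun y ↦ g y (X y) (Y y)) x + (mvfderiv I f x).smulRight (g x (X x) (Y x)) := by
  rw [← mvfderiv_smul hf (mdifferentiableAt_tensor2 hg hX hY)]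
  congr 1; ext y; simp

theorem mvfderiv_tensor2_smul_left {g : Π x : M, Tensor2 I x} (hg : SmoothTensor2 g)
    {X Y : Π x : M, TangentSpace I x} {f : M → ℝ} {x : M} (hf : MDiffAt f x)
    (hX : MDiffAt (T% X) x) (hY : MDiffAt (T% Y) x) :
    mvfderiv I (fun y ↦ g y ((f • X) y) (Y y)) x =
      f x • mvfderiv I (fun y ↦ g y (X y) (Y y)) x + (mvfderiv I f x).smulRight (g x (X x) (Y x)) := by
  rw [← mvfderiv_smul hf (mdifferentiableAt_tensor2 hg hX hY)]
  congr 1; ext y; simp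

theorem mvfderiv_tensor2_add {g : Π x : M, Tensor2 I x} (hg : SmoothTensor2 g)
    {X Y Z : Π x : M, TangentSpace I x} {x : M}
    (hX : MDiffAt (T% X) x) (hY : MDiffAt (T% Y) x) (hZ : MDiffAt (T% Z) x) :
    mvfderiv I (fun y ↦ g y (X y) ((Y + Z) y)) x =
      mvfderiv I (fun y ↦ g y (X y) (Y y)) x + mvfderiv I (fun y ↦ g y (X y) (Z y)) x := by
  rw [← mvfderiv_add (mdifferentiableAt_tensor2 hg hX hY) (mdifferentiableAt_tensor2 hg hX hZ)]
  congr 1; ext y; simp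

theorem mvfderiv_tensor2_add_left {g : Π x : M, Tensor2 I x} (hg : SmoothTensor2 g)
    {X Y Z : Π x : M, TangentSpace I x} {x : M}
    (hX : MDiffAt (T% X) x) (hY : MDiffAt (T% Y) x) (hZ : MDiffAt (T% Z) x) :
    mvfderiv I (fun y ↦ g y ((X + Y) y) (Z y)) x =
      mvfderiv I (fun y ↦ g y (X y) (Z y)) x + mvfderiv I (fun y ↦ g y (Y y) (Z y)) x := by
  rw [← mvfderiv_add (mdifferentiableAt_tensor2 hg hX hZ) (mdifferentiableAt_tensor2 hg hY hZ)]
  congr 1; ext y; simp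

variable [FiniteDimensional ℝ E]

theorem dOneFormFun_tensorial {α : Π x : M, Cotangent I x} {x : M} (hα : DiffCovectorAt α x)
    (X : Π x : M, TangentSpace I x) : TensorialAt I E (dOneFormFun α X · x) x where
  smul {f Y} hf hY := by
    have h1 : mvfderiv I (fun y ↦ α y ((f • Y) y)) x =
        f x • mvfderiv I (fun y ↦ α y (Y y)) x + (mvfderiv I f x).smulRight (α x (Y x)) := by
      rw [← mvfderiv_smul hf (mdifferentiableAt_covector hα hY)]
      congr 1; ext y; simp
    simp only [dOneFormFun, h1, mlieBracket_smul_right hf hY]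
    simp
    ring
  add {Y Z} hY hZ := by
    have h1 : mvfderiv I (fun y ↦ α y ((Y + Z) y)) x =
        mvfderiv I (fun y ↦ α y (Y y)) x + mvfderiv I (fun y ↦ α y (Z y)) x := by
      rw [← mvfderiv_add (mdifferentiableAt_covector hα hY) (mdifferentiableAt_covector hα hZ)]
      congr 1; ext y; simp
    simp only [dOneFormFun, h1, mlieBracket_add_right hY hZ]
    simp
    ring

theorem dOneFormFun_tensorial_left {α : Π x : M, Cotangent I x} {x : M} (hα : DiffCovectorAt α x)
    (Y : Π x : M, TangentSpace I x) : TensorialAt I E (dOneFormFun α · Y x) x where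
  smul {f X} hf hX := by
    rw [dOneFormFun_swap, (dOneFormFun_tensorial hα Y).smul hf hX, dOneFormFun_swap α X]; simp
  add {X Z} hX hZ := by
    rw [dOneFormFun_swap, (dOneFormFun_tensorial hα Y).add hX hZ, dOneFormFun_swap α X,
      dOneFormFun_swap α Z]; ring

theorem dTwoFormFun_tensorial₃ {b : Π x : M, Tensor2 I x} (hb : SmoothTensor2 b)
    (halt : ∀ x v, b x v v = 0) {x : M} {X Y : Π x : M, TangentSpace I x}
    (hX : MDiffAt (T% X) x) (hY : MDiffAt (T% Y) x) :
    TensorialAt I E (dTwoFormFun b X Y · x) x where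
  smul {f Z} hf hZ := by
    simp only [dTwoFormFun, mvfderiv_tensor2_smul hb hf hY hZ,
      mvfderiv_tensor2_smul_left hb hf hZ hX, mlieBracket_smul_right hf hZ,
      mlieBracket_smul_left hf hZ]
    simp
    rw [alternating_swap (halt x) (Z x) (X x), alternating_swap (halt x) (Z x) (Y x)]
    ring
  add {Z W} hZ hW := by
    simp only [dTwoFormFun, mvfderiv_tensor2_add hb hY hZ hW,
      mvfderiv_tensor2_add_left hb hZ hW hX, mlieBracket_add_right hZ hW,
      mlieBracket_add_left hZ hW]
    simp
    ring

theorem dTwoFormFun_tensorial₂ {b : Π x : M, Tensor2 I x} (hb : SmoothTensor2 b)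
    (halt : ∀ x v, b x v v = 0) {x : M} {X Z : Π x : M, TangentSpace I x}
    (hX : MDiffAt (T% X) x) (hZ : MDiffAt (T% Z) x) :
    TensorialAt I E (dTwoFormFun b X · Z x) x := by
  simp only [dTwoFormFun_cyclic b X _ Z, dTwoFormFun_cyclic b _ Z X]
  exact dTwoFormFun_tensorial₃ hb halt hZ hX

theorem dTwoFormFun_tensorial₁ {b : Π x : M, Tensor2 I x} (hb : SmoothTensor2 b)
    (halt : ∀ x v, b x v v = 0) {x : M} {Y Z : Π x : M, TangentSpace I x}
    (hY : MDiffAt (T% Y) x) (hZ : MDiffAt (T% Z) x) :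
    TensorialAt I E (dTwoFormFun b · Y Z x) x := by
  simp only [dTwoFormFun_cyclic b _ Y Z]
  exact dTwoFormFun_tensorial₃ hb halt hY hZ

open Classical in
/-- The exterior derivative of a `1`-form. (Junk value `0` where `α` is not differentiable.) -/
def dOneForm (α : Π x : M, Cotangent I x) (x : M) : Tensor2 I x :=
  if hα : DiffCovectorAt α x then
    TensorialAt.mkHom₂ (fun X Y ↦ dOneFormFun α X Y x) x
      (fun Y _ ↦ dOneFormFun_tensorial_left hα Y) (fun X _ ↦ dOneFormFun_tensorial hα X)
  else 0

theorem dOneForm_apply {α : Π x : M, Cotangent I x} {x : M} (hα : DiffCovectorAt α x)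
    {X Y : Π x : M, TangentSpace I x} (hX : MDiffAt (T% X) x) (hY : MDiffAt (T% Y) x) :
    dOneForm α x (X x) (Y x) = dOneFormFun α X Y x := by
  rw [dOneForm, dif_pos hα, TensorialAt.mkHom₂_apply _ _ hX hY]

/-- Smooth differential `2`-forms. -/
structure TwoForm (I : ModelWithCorners ℝ E B) (M : Type*) [TopologicalSpace M] [ChartedSpace B M]
    [IsManifold I ∞ M] where
  val : Π x : M, TangentSpace I x →L[ℝ] TangentSpace I x →L[ℝ] ℝ
  alt : ∀ x v, val x v v = 0
  smooth : SmoothTensor2 val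

/-- The exterior derivative of a smooth `2`-form. -/
def TwoForm.d (b : TwoForm I M) (x : M) : Tensor3 I x where
  toFun u := TensorialAt.mkHom₂ (fun Y Z ↦ dTwoFormFun b.val (extend E u) Y Z x) x
    (fun _ hZ ↦ dTwoFormFun_tensorial₂ b.smooth b.alt (mdifferentiableAt_extend ..) hZ)
    (fun _ hY ↦ dTwoFormFun_tensorial₃ b.smooth b.alt (mdifferentiableAt_extend ..) hY)
  map_add' u v := by
    ext y z
    have h := dTwoFormFun_tensorial₁ b.smooth b.alt (x := x) (mdifferentiableAt_extend I E y)
      (mdifferentiableAt_extend I E z)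
    simp only [add_apply, TensorialAt.mkHom₂_apply_eq_extend]
    rw [← h.add (mdifferentiableAt_extend ..) (mdifferentiableAt_extend ..)]
    refine h.pointwise (mdifferentiableAt_extend ..) ?_ (by simp)
    exact mdifferentiableAt_add_section (mdifferentiableAt_extend ..) (mdifferentiableAt_extend ..)
  map_smul' c v := by
    ext y z
    have h := dTwoFormFun_tensorial₁ b.smooth b.alt (x := x) (mdifferentiableAt_extend I E y)
      (mdifferentiableAt_extend I E z)
    simp only [smul_apply, TensorialAt.mkHom₂_apply_eq_extend, RingHom.id_apply]
    have h2 := h.smul (f := fun _ ↦ c) (mdifferentiable_const ..) (mdifferentiableAt_extend I E v)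
    rw [smul_eq_mul] at h2 ⊢
    rw [← h2]
    refine h.pointwise (mdifferentiableAt_extend ..) ?_ (by simp)
    exact mdifferentiableAt_const.smul_section (mdifferentiableAt_extend ..)

theorem TwoForm.d_apply (b : TwoForm I M) {x : M} {X Y Z : Π x : M, TangentSpace I x}
    (hX : MDiffAt (T% X) x) (hY : MDiffAt (T% Y) x) (hZ : MDiffAt (T% Z) x) :
    b.d x (X x) (Y x) (Z x) = dTwoFormFun b.val X Y Z x := by
  have h := dTwoFormFun_tensorial₁ b.smooth b.alt (x := x) hY hZ
  change TensorialAt.mkHom₂ _ x _ _ (Y x) (Z x) = _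
  rw [TensorialAt.mkHom₂_apply _ _ hY hZ]
  exact h.pointwise (mdifferentiableAt_extend ..) hX (by simp)


/-- Smooth differential `3`-forms: alternating trilinear forms on the tangent spaces that take
smooth vector fields to smooth functions. -/
structure ThreeForm (I : ModelWithCorners ℝ E B) (M : Type*) [TopologicalSpace M]
    [ChartedSpace B M] [IsManifold I ∞ M] where
  val : Π x : M, Tensor3 I x
  alt_left : ∀ x u v, val x u u v = 0
  alt_right : ∀ x u v, val x u v v = 0
  smooth : ∀ X Y Z : Π x : M, TangentSpace I x, IsSmoothSection I E X → IsSmoothSection I E Y →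
    IsSmoothSection I E Z → ContMDiff I 𝓘(ℝ, ℝ) ∞ (fun x ↦ val x (X x) (Y x) (Z x))

/-! ### Pseudo-Riemannian metrics and the Levi-Civita connection -/

/-- A pseudo-Riemannian metric: a smooth field of nondegenerate symmetric bilinear forms on the
tangent spaces. -/
structure PseudoRiemannianMetric (I : ModelWithCorners ℝ E B) (M : Type*) [TopologicalSpace M]
    [ChartedSpace B M] [IsManifold I ∞ M] where
  val : Π x : M, TangentSpace I x →L[ℝ] TangentSpace I x →L[ℝ] ℝ
  symm : ∀ x u v, val x u v = val x v u
  nondegenerate : ∀ x u, (∀ v, val x u v = 0) → u = 0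
  smooth : SmoothTensor2 val

instance instFiniteDimensionalTangentSpace (x : M) : FiniteDimensional ℝ (TangentSpace I x) :=
  inferInstanceAs (FiniteDimensional ℝ E)

instance instT2SpaceTangentSpace (x : M) : T2Space (TangentSpace I x) :=
  inferInstanceAs (T2Space E)

/-- The musical isomorphism `η♭ : T_x M → T*_x M`, `v ↦ η (v, ·)`. -/
def PseudoRiemannianMetric.flat (η : PseudoRiemannianMetric I M) (x : M) :
    TangentSpace I x ≃ₗ[ℝ] Cotangent I x :=
  LinearEquiv.ofInjectiveOfFinrankEq (η.val x : TangentSpace I x →ₗ[ℝ] Cotangent I x)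
    (by
      rw [← LinearMap.ker_eq_bot, LinearMap.ker_eq_bot']
      intro u hu
      exact η.nondegenerate x u fun v ↦ by simpa using congrArg (fun φ : Cotangent I x ↦ φ v) hu)
    (by
      rw [← LinearEquiv.finrank_eq (LinearMap.toContinuousLinearMap (𝕜 := ℝ)
        (E := TangentSpace I x) (F' := ℝ))]
      exact (Subspace.dual_finrank_eq (K := ℝ) (V := TangentSpace I x)).symm)

theorem PseudoRiemannianMetric.flat_apply (η : PseudoRiemannianMetric I M) (x : M)
    (u v : TangentSpace I x) : η.flat x u v = η.val x u v := rfl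

/-- The inverse musical isomorphism `η♯ : T*_x M → T_x M`. -/
abbrev PseudoRiemannianMetric.sharp (η : PseudoRiemannianMetric I M) (x : M) :
    Cotangent I x ≃ₗ[ℝ] TangentSpace I x := (η.flat x).symm

theorem PseudoRiemannianMetric.val_sharp (η : PseudoRiemannianMetric I M) (x : M)
    (φ : Cotangent I x) (v : TangentSpace I x) : η.val x (η.sharp x φ) v = φ v := by
  rw [← η.flat_apply, LinearEquiv.apply_symm_apply]

/-- `∇` is a Levi-Civita connection of `η`: it is torsion free and it preserves `η`. -/
structure IsLeviCivita (η : PseudoRiemannianMetric I M)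
    (cov : CovariantDerivative I E (TangentSpace I : M → Type _)) : Prop where
  torsion_eq_zero : ∀ (X Y : Π x : M, TangentSpace I x) (x : M), MDiffAt (T% X) x →
    MDiffAt (T% Y) x → cov Y x (X x) - cov X x (Y x) = mlieBracket I X Y x
  metric : ∀ (X Y Z : Π x : M, TangentSpace I x) (x : M), MDiffAt (T% Y) x → MDiffAt (T% Z) x →
    mvfderiv I (fun y ↦ η.val y (Y y) (Z y)) x (X x)
      = η.val x (cov Y x (X x)) (Z x) + η.val x (Y x) (cov Z x (X x))

/-- The right hand side of the Koszul formula for `2 η (∇_X Y, Z)`. -/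
def koszul (η : PseudoRiemannianMetric I M) (X Y Z : Π x : M, TangentSpace I x) (x : M) : ℝ :=
  mvfderiv I (fun y ↦ η.val y (Y y) (Z y)) x (X x) + mvfderiv I (fun y ↦ η.val y (X y) (Z y)) x (Y x)
    - mvfderiv I (fun y ↦ η.val y (X y) (Y y)) x (Z x) + η.val x (mlieBracket I X Y x) (Z x)
    - η.val x (mlieBracket I X Z x) (Y x) - η.val x (mlieBracket I Y Z x) (X x)

theorem koszul_tensorial₁ (η : PseudoRiemannianMetric I M) {x : M}
    {Y Z : Π x : M, TangentSpace I x} (hY : MDiffAt (T% Y) x) (hZ : MDiffAt (T% Z) x) :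
    TensorialAt I E (koszul η · Y Z x) x where
  smul {f X} hf hX := by
    simp only [koszul, mvfderiv_tensor2_smul_left η.smooth hf hX hZ,
      mvfderiv_tensor2_smul_left η.smooth hf hX hY, mlieBracket_smul_left hf hX]
    simp
    ring
  add {X W} hX hW := by
    simp only [koszul, mvfderiv_tensor2_add_left η.smooth hX hW hZ,
      mvfderiv_tensor2_add_left η.smooth hX hW hY, mlieBracket_add_left hX hW]
    simp
    ring

theorem koszul_tensorial₃ (η : PseudoRiemannianMetric I M) {x : M}
    {X Y : Π x : M, TangentSpace I x} (hX : MDiffAt (T% X) x) (hY : MDiffAt (T% Y) x) :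
    TensorialAt I E (koszul η X Y · x) x where
  smul {f Z} hf hZ := by
    simp only [koszul, mvfderiv_tensor2_smul η.smooth hf hX hZ,
      mvfderiv_tensor2_smul η.smooth hf hY hZ, mlieBracket_smul_right hf hZ]
    simp
    rw [η.symm x (Z x) (X x), η.symm x (Z x) (Y x)]
    ring
  add {Z W} hZ hW := by
    simp only [koszul, mvfderiv_tensor2_add η.smooth hX hZ hW,
      mvfderiv_tensor2_add η.smooth hY hZ hW, mlieBracket_add_right hZ hW]
    simp
    ring

theorem koszul_add (η : PseudoRiemannianMetric I M) {x : M} {X Y Y' Z : Π x : M, TangentSpace I x}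
    (hX : MDiffAt (T% X) x) (hY : MDiffAt (T% Y) x) (hY' : MDiffAt (T% Y') x)
    (hZ : MDiffAt (T% Z) x) :
    koszul η X (Y + Y') Z x = koszul η X Y Z x + koszul η X Y' Z x := by
  simp only [koszul, mvfderiv_tensor2_add_left η.smooth hY hY' hZ,
    mvfderiv_tensor2_add η.smooth hX hY hY', mlieBracket_add_left hY hY',
    mlieBracket_add_right hY hY']
  simp
  ring

theorem koszul_smul (η : PseudoRiemannianMetric I M) {x : M} {X Y Z : Π x : M, TangentSpace I x}
    {f : M → ℝ} (hf : MDiffAt f x) (hX : MDiffAt (T% X) x) (hY : MDiffAt (T% Y) x)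
    (hZ : MDiffAt (T% Z) x) :
    koszul η X (f • Y) Z x
      = f x * koszul η X Y Z x + 2 * (mvfderiv I f x (X x) * η.val x (Y x) (Z x)) := by
  simp only [koszul, mvfderiv_tensor2_smul_left η.smooth hf hY hZ,
    mvfderiv_tensor2_smul η.smooth hf hX hY, mlieBracket_smul_left hf hY,
    mlieBracket_smul_right hf hY]
  simp
  rw [η.symm x (Y x) (X x)]
  ring

open Classical in
/-- The map `v ↦ ∇_v Y` at the point `x` defined by the Koszul formula. -/
def koszulDeriv (η : PseudoRiemannianMetric I M) (Y : Π x : M, TangentSpace I x) (x : M) :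
    TangentSpace I x →L[ℝ] TangentSpace I x :=
  if hY : MDiffAt (T% Y) x then
    LinearMap.toContinuousLinearMap ((η.sharp x : Cotangent I x →ₗ[ℝ] TangentSpace I x) ∘ₗ
      (((1 / 2 : ℝ) • TensorialAt.mkHom₂ (fun X Z ↦ koszul η X Y Z x) x
        (fun _ hZ ↦ koszul_tensorial₁ η hY hZ) (fun _ hX ↦ koszul_tensorial₃ η hX hY) :
          Tensor2 I x) : TangentSpace I x →ₗ[ℝ] Cotangent I x))
  else 0

theorem val_koszulDeriv (η : PseudoRiemannianMetric I M) {x : M}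
    {X Y Z : Π x : M, TangentSpace I x} (hX : MDiffAt (T% X) x) (hY : MDiffAt (T% Y) x)
    (hZ : MDiffAt (T% Z) x) :
    η.val x (koszulDeriv η Y x (X x)) (Z x) = 1 / 2 * koszul η X Y Z x := by
  rw [koszulDeriv, dif_pos hY]
  simp only [LinearMap.coe_toContinuousLinearMap', LinearMap.comp_apply, LinearEquiv.coe_coe]
  rw [η.val_sharp]
  simp [TensorialAt.mkHom₂_apply _ _ hX hZ]

/-- Vectors are determined by their products with the values of differentiable vector fields. -/
theorem PseudoRiemannianMetric.ext_diff (η : PseudoRiemannianMetric I M) {x : M}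
    {u v : TangentSpace I x} (h : ∀ Z : Π x : M, TangentSpace I x, MDiffAt (T% Z) x →
      η.val x u (Z x) = η.val x v (Z x)) : u = v := by
  rw [← sub_eq_zero]
  refine η.nondegenerate x _ fun w ↦ ?_
  have := h (extend E w) (mdifferentiableAt_extend ..)
  simpa [sub_eq_zero] using this

theorem exists_isLeviCivita (η : PseudoRiemannianMetric I M) :
    ∃ cov : CovariantDerivative I E (TangentSpace I : M → Type _), IsLeviCivita η cov := by
  refine ⟨⟨koszulDeriv η, ?_⟩, ?_, ?_⟩
  · constructor
    · intro Y Y' x hY hY' _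
      have hs : MDiffAt (T% (Y + Y')) x := mdifferentiableAt_add_section hY hY'
      ext v
      refine η.ext_diff fun Z hZ ↦ ?_
      have hv := mdifferentiableAt_extend I E v
      have e : v = extend E v x := by simp
      rw [e, val_koszulDeriv η hv hs hZ, koszul_add η hv hY hY' hZ]
      simp only [add_apply, map_add]
      rw [val_koszulDeriv η hv hY hZ, val_koszulDeriv η hv hY' hZ]
      ring
    · intro Y f x hY hf _
      have hs : MDiffAt (T% (f • Y)) x := hf.smul_section hY
      ext v
      refine η.ext_diff fun Z hZ ↦ ?_
      have hv := mdifferentiableAt_extend I E v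
      have e : v = extend E v x := by simp
      rw [e, val_koszulDeriv η hv hs hZ, koszul_smul η hf hv hY hZ]
      simp only [add_apply, map_add, smul_apply, map_smul, ContinuousLinearMap.smulRight_apply]
      rw [val_koszulDeriv η hv hY hZ]
      simp only [smul_eq_mul]
      ring
  · intro X Y x hX hY
    refine η.ext_diff fun Z hZ ↦ ?_
    simp only [map_sub, sub_apply]
    rw [val_koszulDeriv η hX hY hZ, val_koszulDeriv η hY hX hZ, koszul, koszul,
      mlieBracket_swap_apply (V := Y) (W := X)]
    simp only [η.symm _ (Y _) (X _)]
    simp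
    ring
  · intro X Y Z x hY hZ
    have hv := mdifferentiableAt_extend I E (X x)
    have e : X x = extend E (X x) x := by simp
    rw [η.symm x (Y x), e, val_koszulDeriv η hv hY hZ, val_koszulDeriv η hv hZ hY, koszul, koszul,
      mlieBracket_swap_apply (V := Z) (W := Y)]
    simp only [η.symm _ (Z _) (Y _)]
    simp
    ring

/-- The Levi-Civita connection `∇` of `η`; `leviCivita η Y x (X x)` is `∇_X Y` at `x`. -/
def leviCivita (η : PseudoRiemannianMetric I M) :
    CovariantDerivative I E (TangentSpace I : M → Type _) := (exists_isLeviCivita η).choose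

theorem isLeviCivita_leviCivita (η : PseudoRiemannianMetric I M) : IsLeviCivita η (leviCivita η) :=
  (exists_isLeviCivita η).choose_spec


/-! ### Metric algebroids -/

section Algebroid

variable {F : Type*} [NormedAddCommGroup F] [NormedSpace ℝ F] {V : M → Type*}
  [TopologicalSpace (TotalSpace F V)] [∀ x, TopologicalSpace (V x)] [∀ x, AddCommGroup (V x)]
  [∀ x, Module ℝ (V x)] [FiberBundle F V]
  {F' : Type*} [NormedAddCommGroup F'] [NormedSpace ℝ F'] {V' : M → Type*}
  [TopologicalSpace (TotalSpace F' V')] [∀ x, TopologicalSpace (V' x)] [∀ x, AddCommGroup (V' x)]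
  [∀ x, Module ℝ (V' x)] [FiberBundle F' V']

/-- A family of subspaces `W x ⊆ V x` is a smooth vector subbundle of `V`: near every point it is
spanned by a smooth frame. -/
def IsSmoothSubbundle (I : ModelWithCorners ℝ E B) (F : Type*) [NormedAddCommGroup F]
    [NormedSpace ℝ F] {V : M → Type*} [TopologicalSpace (TotalSpace F V)]
    [∀ x, TopologicalSpace (V x)] [∀ x, AddCommGroup (V x)] [∀ x, Module ℝ (V x)]
    [FiberBundle F V] (W : Π x : M, Submodule ℝ (V x)) : Prop :=
  ∀ x₀ : M, ∃ U ∈ 𝓝 x₀, ∃ (k : ℕ) (s : Fin k → Π x : M, V x),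
    (∀ i, ContMDiffOn I (I.prod 𝓘(ℝ, F)) ∞ (fun x ↦ TotalSpace.mk' F x (s i x)) U) ∧
    ∀ x ∈ U, LinearIndependent ℝ (fun i ↦ s i x) ∧
      Submodule.span ℝ (Set.range fun i ↦ s i x) = W x

/-- The structure maps of an algebroid with a pairing, on a vector bundle that is given as a
subbundle (with fibres `fiber x`) of a vector bundle `V`; a vector bundle `V` itself is the case
`fiber x = ⊤`. The bracket is a map on all sections, but only its values on smooth sections have a
meaning. -/
structure AlgebroidData (I : ModelWithCorners ℝ E B) (V : M → Type*)
    [∀ x, AddCommGroup (V x)] [∀ x, Module ℝ (V x)] where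
  fiber : Π x : M, Submodule ℝ (V x)
  bracket : (Π x, fiber x) → (Π x, fiber x) → Π x, fiber x
  pairing : Π x, fiber x →ₗ[ℝ] fiber x →ₗ[ℝ] ℝ
  anchor : Π x, fiber x →ₗ[ℝ] TangentSpace I x

namespace AlgebroidData

/-- `ξ` is a smooth section of the underlying vector bundle (smooth as a section of `V`). -/
def IsSmooth (F : Type*) [NormedAddCommGroup F] [NormedSpace ℝ F] {V : M → Type*}
    [TopologicalSpace (TotalSpace F V)] [∀ x, TopologicalSpace (V x)] [∀ x, AddCommGroup (V x)]
    [∀ x, Module ℝ (V x)] [FiberBundle F V] (A : AlgebroidData I V) (ξ : Π x, A.fiber x) : Prop :=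
  IsSmoothSection I F (fun x ↦ (ξ x : V x))

/-- The axioms of a metric algebroid: a vector bundle with an `ℝ`-bilinear bracket on its smooth
sections, a smooth anchor, and a smooth fibrewise nondegenerate symmetric pairing, such that the
anchored derivation property holds and the pairing is preserved by the bracket. -/
structure IsMetricAlgebroid (F : Type*) [NormedAddCommGroup F] [NormedSpace ℝ F] {V : M → Type*}
    [TopologicalSpace (TotalSpace F V)] [∀ x, TopologicalSpace (V x)] [∀ x, AddCommGroup (V x)]
    [∀ x, Module ℝ (V x)] [FiberBundle F V] (A : AlgebroidData I V) : Prop where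
  isSmoothSubbundle : IsSmoothSubbundle I F A.fiber
  bracket_smooth : ∀ e₁ e₂, A.IsSmooth F e₁ → A.IsSmooth F e₂ → A.IsSmooth F (A.bracket e₁ e₂)
  pairing_smooth : ∀ e₁ e₂, A.IsSmooth F e₁ → A.IsSmooth F e₂ →
    ContMDiff I 𝓘(ℝ, ℝ) ∞ (fun x ↦ A.pairing x (e₁ x) (e₂ x))
  anchor_smooth : ∀ e, A.IsSmooth F e → IsSmoothSection I E (fun x ↦ A.anchor x (e x))
  bracket_add_left : ∀ e₁ e₂ e₃, A.IsSmooth F e₁ → A.IsSmooth F e₂ → A.IsSmooth F e₃ →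
    A.bracket (e₁ + e₂) e₃ = A.bracket e₁ e₃ + A.bracket e₂ e₃
  bracket_add_right : ∀ e₁ e₂ e₃, A.IsSmooth F e₁ → A.IsSmooth F e₂ → A.IsSmooth F e₃ →
    A.bracket e₁ (e₂ + e₃) = A.bracket e₁ e₂ + A.bracket e₁ e₃
  bracket_smul_left : ∀ (c : ℝ) (e₁ e₂), A.IsSmooth F e₁ → A.IsSmooth F e₂ →
    A.bracket (c • e₁) e₂ = c • A.bracket e₁ e₂
  bracket_smul_right : ∀ (c : ℝ) (e₁ e₂), A.IsSmooth F e₁ → A.IsSmooth F e₂ →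
    A.bracket e₁ (c • e₂) = c • A.bracket e₁ e₂
  leibniz : ∀ (f : M → ℝ) (e₁ e₂), ContMDiff I 𝓘(ℝ, ℝ) ∞ f → A.IsSmooth F e₁ → A.IsSmooth F e₂ →
    ∀ x, A.bracket e₁ (fun y ↦ f y • e₂ y) x
      = f x • A.bracket e₁ e₂ x + mvfderiv I f x (A.anchor x (e₁ x)) • e₂ x
  pairing_symm : ∀ x u v, A.pairing x u v = A.pairing x v u
  pairing_nondegenerate : ∀ x u, (∀ v, A.pairing x u v = 0) → u = 0
  pairing_bracket : ∀ e e₁ e₂, A.IsSmooth F e → A.IsSmooth F e₁ → A.IsSmooth F e₂ →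
    ∀ x, mvfderiv I (fun y ↦ A.pairing y (e₁ y) (e₂ y)) x (A.anchor x (e x))
      = A.pairing x (A.bracket e e₁ x) (e₂ x) + A.pairing x (e₁ x) (A.bracket e e₂ x)
  pairing_bracket_self : ∀ e e₁, A.IsSmooth F e → A.IsSmooth F e₁ →
    ∀ x, A.pairing x (A.bracket e e x) (e₁ x)
      = 1 / 2 * mvfderiv I (fun y ↦ A.pairing y (e y) (e y)) x (A.anchor x (e₁ x))

/-- An isomorphism of metric algebroids over the same manifold: a smooth isomorphism `ψ` of vector
bundles over the identity (that is, fibrewise linear isomorphisms such that `ψ` and its inverse take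
smooth sections to smooth sections) that intertwines the anchors and the brackets of smooth sections
and is an isometry. -/
structure IsIso (F : Type*) [NormedAddCommGroup F] [NormedSpace ℝ F] {V : M → Type*}
    [TopologicalSpace (TotalSpace F V)] [∀ x, TopologicalSpace (V x)] [∀ x, AddCommGroup (V x)]
    [∀ x, Module ℝ (V x)] [FiberBundle F V]
    (F' : Type*) [NormedAddCommGroup F'] [NormedSpace ℝ F'] {V' : M → Type*}
    [TopologicalSpace (TotalSpace F' V')] [∀ x, TopologicalSpace (V' x)]
    [∀ x, AddCommGroup (V' x)] [∀ x, Module ℝ (V' x)] [FiberBundle F' V']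
    (A : AlgebroidData I V) (A' : AlgebroidData I V')
    (ψ : Π x, A.fiber x ≃ₗ[ℝ] A'.fiber x) : Prop where
  smooth : ∀ e, A.IsSmooth F e → A'.IsSmooth F' (fun x ↦ ψ x (e x))
  symm_smooth : ∀ e, A'.IsSmooth F' e → A.IsSmooth F (fun x ↦ (ψ x).symm (e x))
  anchor : ∀ x u, A'.anchor x (ψ x u) = A.anchor x u
  bracket : ∀ e₁ e₂, A.IsSmooth F e₁ → A.IsSmooth F e₂ →
    (fun x ↦ ψ x (A.bracket e₁ e₂ x)) = A'.bracket (fun x ↦ ψ x (e₁ x)) (fun x ↦ ψ x (e₂ x))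
  isometry : ∀ x u v, A'.pairing x (ψ x u) (ψ x v) = A.pairing x u v

end AlgebroidData

end Algebroid

/-! ### The metric algebroid on the tangent bundle -/

/-- The D-bracket of the Levi-Civita connection twisted by a field `T` of trilinear forms. It is the
vector field determined by `η (⟦X, Y⟧, Z) = η (∇_X Y - ∇_Y X, Z) + η (∇_Z X, Y) + T (X, Y, Z) / 2`;
the twist is normalized with the factor `1 / 2`. -/
def twistedDBracket (η : PseudoRiemannianMetric I M) (T : Π x : M, Tensor3 I x)
    (X Y : Π x : M, TangentSpace I x) (x : M) : TangentSpace I x :=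
  leviCivita η Y x (X x) - leviCivita η X x (Y x)
    + η.sharp x ((η.val x (Y x)).comp (leviCivita η X x))
    + (1 / 2 : ℝ) • η.sharp x (T x (X x) (Y x))

theorem val_twistedDBracket (η : PseudoRiemannianMetric I M) (T : Π x : M, Tensor3 I x)
    (X Y Z : Π x : M, TangentSpace I x) (x : M) :
    η.val x (twistedDBracket η T X Y x) (Z x)
      = η.val x (leviCivita η Y x (X x) - leviCivita η X x (Y x)) (Z x)
        + η.val x (leviCivita η X x (Z x)) (Y x) + 1 / 2 * T x (X x) (Y x) (Z x) := by
  simp only [twistedDBracket, map_add, add_apply, map_smul, smul_apply, η.val_sharp, smul_eq_mul,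
    ContinuousLinearMap.comp_apply]
  rw [η.symm x (Y x)]

/-- The data `(TM, ⟦·,·⟧, η, id)`, with the D-bracket twisted by `T`. -/
def tangentAlgebroid (η : PseudoRiemannianMetric I M) (T : Π x : M, Tensor3 I x) :
    AlgebroidData I (TangentSpace I : M → Type _) where
  fiber _ := ⊤
  bracket X Y x := ⟨twistedDBracket η T (fun y ↦ X y) (fun y ↦ Y y) x, Submodule.mem_top⟩
  pairing x := LinearMap.mk₂ ℝ (fun u v ↦ η.val x u v) (by simp) (by simp) (by simp) (by simp)
  anchor _ := Submodule.subtype ⊤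

/-! ### The generalized tangent bundle and the `H`-twisted standard Courant algebroid -/

/-- The fibres of the generalized tangent bundle `TM ⊕ T*M`. -/
abbrev GenTangent (I : ModelWithCorners ℝ E B) (x : M) : Type _ := TangentSpace I x × Cotangent I x

/-- The pairing `⟨X + α, Y + β⟩ = β X + α Y`. -/
def genPairing (I : ModelWithCorners ℝ E B) (x : M) :
    GenTangent I x →ₗ[ℝ] GenTangent I x →ₗ[ℝ] ℝ :=
  LinearMap.mk₂ ℝ (fun u v ↦ v.2 u.1 + u.2 v.1) (by intros; simp; ring) (by intros; simp; ring)
    (by intros; simp; ring) (by intros; simp; ring)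

/-- The Lie derivative of a `1`-form, `L_X β = ι_X dβ + d (β X)`. -/
def lieDerivOneForm (X : Π x : M, TangentSpace I x) (β : Π x : M, Cotangent I x) (x : M) :
    Cotangent I x :=
  dOneForm β x (X x) + mvfderiv I (fun y ↦ β y (X y)) x

/-- The `H`-twisted Dorfman bracket
`[X + α, Y + β] = [X, Y] + L_X β - ι_Y dα + H (X, Y, ·)`. -/
def dorfman (H : ThreeForm I M) (e₁ e₂ : Π x : M, GenTangent I x) (x : M) : GenTangent I x :=
  (mlieBracket I (fun y ↦ (e₁ y).1) (fun y ↦ (e₂ y).1) x,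
    lieDerivOneForm (fun y ↦ (e₁ y).1) (fun y ↦ (e₂ y).2) x
      - dOneForm (fun y ↦ (e₁ y).2) x (e₂ x).1 + H.val x (e₁ x).1 (e₂ x).1)

/-! ### The generalized metric and its eigenbundles -/

/-- The endomorphism `I₀ (X + α) = η♯ α + η♭ X` of `TM ⊕ T*M`. -/
def genMetricZero (η : PseudoRiemannianMetric I M) (x : M) : Module.End ℝ (GenTangent I x) :=
  ((η.sharp x : Cotangent I x →ₗ[ℝ] TangentSpace I x) ∘ₗ LinearMap.snd ℝ _ _).prod
    ((η.flat x : TangentSpace I x →ₗ[ℝ] Cotangent I x) ∘ₗ LinearMap.fst ℝ _ _)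

/-- The endomorphism `B₊ (X + α) = b♭ X` of `TM ⊕ T*M`, where `b♭ X = b (X, ·)`. -/
def bPlus (b : TwoForm I M) (x : M) : Module.End ℝ (GenTangent I x) :=
  LinearMap.prod 0 ((b.val x : TangentSpace I x →ₗ[ℝ] Cotangent I x) ∘ₗ LinearMap.fst ℝ _ _)

/-- The `B₊`-transform `e^{B₊} ∘ I₀ ∘ e^{-B₊}` of `I₀`. As `B₊ ∘ B₊ = 0`, one has
`e^{B₊} = 1 + B₊` and `e^{-B₊} = 1 - B₊`. -/
def genMetric (η : PseudoRiemannianMetric I M) (b : TwoForm I M) (x : M) :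
    Module.End ℝ (GenTangent I x) :=
  (1 + bPlus b x) * genMetricZero η x * (1 - bPlus b x)

theorem genMetric_mul_self (η : PseudoRiemannianMetric I M) (b : TwoForm I M) (x : M) :
    genMetric η b x * genMetric η b x = 1 := by
  have h0 : genMetricZero η x * genMetricZero η x = 1 := by
    ext v <;> simp [genMetricZero]
  have h1 : (1 - bPlus b x) * (1 + bPlus b x) = 1 := by
    refine LinearMap.ext fun v ↦ Prod.ext ?_ ?_ <;> simp [bPlus]
  have h2 : (1 + bPlus b x) * (1 - bPlus b x) = 1 := by
    refine LinearMap.ext fun v ↦ Prod.ext ?_ ?_ <;> simp [bPlus]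
  calc genMetric η b x * genMetric η b x
      = (1 + bPlus b x) * genMetricZero η x * ((1 - bPlus b x) * (1 + bPlus b x))
        * genMetricZero η x * (1 - bPlus b x) := by simp only [genMetric, mul_assoc]
    _ = (1 + bPlus b x) * (genMetricZero η x * genMetricZero η x) * (1 - bPlus b x) := by
        rw [h1, mul_one]; simp only [mul_assoc]
    _ = 1 := by rw [h0, mul_one, h2]

/-- The eigenbundle `C_ε` of the generalized metric for the eigenvalue `ε = ± 1`. -/
def eigenbundle (η : PseudoRiemannianMetric I M) (b : TwoForm I M) (ε : ℤˣ) (x : M) :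
    Submodule ℝ (GenTangent I x) :=
  Module.End.eigenspace (genMetric η b x) ((ε : ℤ) : ℝ)

theorem isCompl_eigenspace_involution {W : Type*} [AddCommGroup W] [Module ℝ W]
    {J : Module.End ℝ W} (hJ : J * J = 1) (ε : ℤˣ) :
    IsCompl (J.eigenspace ((ε : ℤ) : ℝ)) (J.eigenspace (((-ε : ℤˣ) : ℤ) : ℝ)) := by
  have hJ' : ∀ v, J (J v) = v := fun v ↦ by rw [← Module.End.mul_apply, hJ]; rfl
  have hε : ((ε : ℤ) : ℝ) * ((ε : ℤ) : ℝ) = 1 := by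
    rcases Int.units_eq_one_or ε with h | h <;> simp [h]
  have hn : (((-ε : ℤˣ) : ℤ) : ℝ) = - ((ε : ℤ) : ℝ) := by push_cast; ring
  rw [hn]
  generalize ((ε : ℤ) : ℝ) = c at hε
  constructor
  · rw [Submodule.disjoint_def]
    intro v h1 h2
    rw [Module.End.mem_eigenspace_iff] at h1 h2
    rw [h1] at h2
    have h3 : (2 * c) • v = 0 := by
      have : c • v - (-c) • v = 0 := sub_eq_zero.2 h2
      rw [← this]; module
    refine (smul_eq_zero.1 h3).resolve_left fun h ↦ ?_
    have : c = 0 := by linarith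
    simp [this] at hε
  · rw [codisjoint_iff, Submodule.eq_top_iff']
    intro v
    refine Submodule.mem_sup.2 ⟨(1 / 2 : ℝ) • (v + c • J v), ?_,
      (1 / 2 : ℝ) • (v - c • J v), ?_, by module⟩
    · rw [Module.End.mem_eigenspace_iff, map_smul, map_add, map_smul, hJ',
        smul_comm c (1 / 2 : ℝ), smul_add c, smul_smul c c, hε, one_smul, add_comm]
    · rw [Module.End.mem_eigenspace_iff, map_smul, map_sub, map_smul, hJ',
        smul_comm (-c) (1 / 2 : ℝ), smul_sub (-c), smul_smul (-c) c, neg_mul, hε]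
      module

theorem isCompl_eigenbundle (η : PseudoRiemannianMetric I M) (b : TwoForm I M) (ε : ℤˣ) (x : M) :
    IsCompl (eigenbundle η b ε x) (eigenbundle η b (-ε) x) :=
  isCompl_eigenspace_involution (genMetric_mul_self η b x) ε

/-- The projection `p_ε` of `TM ⊕ T*M` onto `C_ε` along `C_{-ε}`. -/
def eigenProjection (η : PseudoRiemannianMetric I M) (b : TwoForm I M) (ε : ℤˣ) (x : M) :
    GenTangent I x →ₗ[ℝ] eigenbundle η b ε x :=
  Submodule.projectionOnto _ _ (isCompl_eigenbundle η b ε x)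

/-- The structure maps induced on `C_ε` by the `H`-twisted standard Courant algebroid: the bracket
`p_ε [i ξ, i ξ']`, the pairing `(ε / 2) ⟨i ξ, i ξ'⟩` and the anchor `ρ ∘ i`. -/
def eigenAlgebroid (η : PseudoRiemannianMetric I M) (b : TwoForm I M) (H : ThreeForm I M)
    (ε : ℤˣ) : AlgebroidData I (GenTangent I : M → Type _) where
  fiber := eigenbundle η b ε
  bracket ξ ξ' x := eigenProjection η b ε x (dorfman H (fun y ↦ ξ y) (fun y ↦ ξ' y) x)
  pairing x := (((ε : ℤ) : ℝ) * (1 / 2)) •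
    (genPairing I x).compl₁₂ (eigenbundle η b ε x).subtype (eigenbundle η b ε x).subtype
  anchor x := LinearMap.fst ℝ _ _ ∘ₗ (eigenbundle η b ε x).subtype

/-- The field of trilinear forms `ε (H + db)`. -/
def twistForm (b : TwoForm I M) (H : ThreeForm I M) (ε : ℤˣ) (x : M) : Tensor3 I x :=
  ((ε : ℤ) : ℝ) • (H.val x + b.d x)

end

end DoubledGeometry

open DoubledGeometry

/-!
The anchor of `C_ε` sends `X + b X + ε η X` to `X`, so it is an isomorphism of vector bundles from
`C_ε = Graph (b + ε η)` to the tangent bundle, and it is an isometry for the pairing `(ε / 2) ⟨·, ·⟩`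
(`genPairing_graphVector`). It remains to compare the brackets. As `C_{-ε}` is orthogonal to `C_ε`,
the projection of a Dorfman bracket to `C_ε` is determined by its pairings with sections of `C_ε`
(`eigenProjection_eq_graphVector`). Such a pairing splits into three groups of terms: those with `η`
are the Koszul expression of the D-bracket (`val_twistedDBracket_eq_koszul`), those with `b` are the
invariant formula for `db`, and the last one is `H`. This is `genPairing_dorfman_graphVector`.

The axioms of a metric algebroid are checked on the tangent bundle only, for an arbitrary smooth
`3`-form as twist (`isMetricAlgebroid_tangentAlgebroid`), where they follow from the properties of
the Levi-Civita connection and of alternating forms; they are then transported to `C_ε`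
(`AlgebroidData.IsIso.isMetricAlgebroid`). The smoothness of the D-bracket `⟦X, Y⟧` follows from the
smoothness of the functions `η (⟦X, Y⟧, Z)`, which the Koszul formula expresses by derivatives and
Lie brackets; that this suffices is `PseudoRiemannianMetric.isSmoothSection_of_val`.
-/

namespace DoubledGeometry

noncomputable section

variable {E : Type*} [NormedAddCommGroup E] [NormedSpace ℝ E]
  {B : Type*} [TopologicalSpace B] {I : ModelWithCorners ℝ E B}
  {M : Type*} [TopologicalSpace M] [ChartedSpace B M]

/-! ### Smoothness criteria -/

/-- A family of continuous linear maps on a finite-dimensional space is smooth at a point as soon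
as all its evaluations are. -/
theorem contMDiffAt_clm_of_forall_apply {F G : Type*}
    [NormedAddCommGroup F] [NormedSpace ℝ F] [FiniteDimensional ℝ F] [NormedAddCommGroup G]
    [NormedSpace ℝ G] {f : M → F →L[ℝ] G} {x₀ : M}
    (h : ∀ v, ContMDiffAt I 𝓘(ℝ, G) ∞ (fun x ↦ f x v) x₀) :
    ContMDiffAt I 𝓘(ℝ, F →L[ℝ] G) ∞ f x₀ := by
  let e₁ : F ≃L[ℝ] (Fin (Module.finrank ℝ F) → ℝ) :=
    ContinuousLinearEquiv.ofFinrankEq (Module.finrank_fin_fun ℝ).symm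
  let e₂ := (e₁.arrowCongr (1 : G ≃L[ℝ] G)).trans
    (ContinuousLinearEquiv.piRing (Fin (Module.finrank ℝ F)))
  have h2 : ContMDiffAt I 𝓘(ℝ, Fin (Module.finrank ℝ F) → G) ∞ (fun x ↦ e₂ (f x)) x₀ :=
    contMDiffAt_pi_space.2 fun i ↦ h _
  have h3 := (e₂.symm.contDiff (n := ∞)).contMDiff.contMDiffAt.comp x₀ h2
  exact h3.congr_of_eventuallyEq (.of_forall fun x ↦ (e₂.symm_apply_apply (f x)).symm)

variable [IsManifold I ∞ M]

/-- The vector field that is constant in a trivialization of the tangent bundle is smooth on the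
base set of the trivialization. -/
theorem contMDiffOn_trivialization_symm (x₀ : M) (u : E) :
    CMDiff[(trivializationAt E (TangentSpace I) x₀).baseSet] ∞
      (T% fun x : M ↦ (trivializationAt E (TangentSpace I) x₀).symm x u) := by
  rw [Bundle.Trivialization.contMDiffOn_section_baseSet_iff]
  apply (contMDiffOn_const (c := u)).congr
  intro y hy
  exact congrArg Prod.snd (Bundle.Trivialization.apply_mk_symm _ hy u)

/-- A vector field that is smooth near a point agrees near this point with a globally smooth
one. -/
theorem exists_isSmoothSection_eventuallyEq [FiniteDimensional ℝ E] [T2Space M]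
    {Z : Π x : M, TangentSpace I x} {U : Set M} {x₀ : M} (hU : IsOpen U) (hx : x₀ ∈ U)
    (hZ : CMDiff[U] ∞ (T% Z)) :
    ∃ Z' : Π x : M, TangentSpace I x, IsSmoothSection I E Z' ∧ ∀ᶠ x in 𝓝 x₀, Z' x = Z x := by
  obtain ⟨χ, hχ, -⟩ := (SmoothBumpFunction.nhds_basis_support (I := I) (hU.mem_nhds hx)).mem_iff.1
    (hU.mem_nhds hx)
  refine ⟨(χ : M → ℝ) • Z, ?_, ?_⟩
  · exact ContMDiffOn.smul_section_of_tsupport χ.contMDiff.contMDiffOn hU hχ hZ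
  · filter_upwards [χ.eventuallyEq_one] with x hx
    simp [hx]

/-- A vector field `V` is smooth if all functions `η (V, Z)` with smooth `Z` are. In a
trivialization of the tangent bundle, `V` is obtained from these functions by the inverse of the
Gram operator of `η`, which depends smoothly on the point. -/
theorem PseudoRiemannianMetric.isSmoothSection_of_val [FiniteDimensional ℝ E] [T2Space M]
    (η : PseudoRiemannianMetric I M) {V : Π x : M, TangentSpace I x}
    (hV : ∀ Z : Π x : M, TangentSpace I x, IsSmoothSection I E Z →
      ContMDiff I 𝓘(ℝ, ℝ) ∞ (fun x ↦ η.val x (V x) (Z x))) :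
    IsSmoothSection I E V := by
  intro x₀
  have : CompleteSpace E := FiniteDimensional.complete ℝ E
  set e := trivializationAt E (TangentSpace I : M → Type _) x₀ with he
  have hx₀ : x₀ ∈ e.baseSet := FiberBundle.mem_baseSet_trivializationAt' x₀
  have hsymm (u : E) : CMDiffAt ∞ (T% fun x : M ↦ e.symm x u) x₀ :=
    (contMDiffOn_trivialization_symm x₀ u).contMDiffAt (e.open_baseSet.mem_nhds hx₀)
  -- `N` is the Gram operator; `Trivialization.symmₗ` is used because it is linear everywhere, and
  -- agrees with `Trivialization.symm` on the base set.
  let N (x : M) : E →L[ℝ] E →L[ℝ] ℝ := LinearMap.toContinuousBilinearMap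
    (LinearMap.mk₂ ℝ (fun u v ↦ η.val x (e.symmₗ ℝ x u) (e.symmₗ ℝ x v))
      (by simp) (by simp) (by simp) (by simp))
  have N_apply {x : M} (hx : x ∈ e.baseSet) (u v : E) :
      N x u v = η.val x (e.symm x u) (e.symm x v) :=
    congrArg₂ (fun a b ↦ η.val x a b) (e.symmₗ_apply (R := ℝ) hx u) (e.symmₗ_apply (R := ℝ) hx v)
  have hN : ContMDiffAt I 𝓘(ℝ, E →L[ℝ] E →L[ℝ] ℝ) ∞ N x₀ := by
    refine contMDiffAt_clm_of_forall_apply fun u ↦ contMDiffAt_clm_of_forall_apply fun v ↦ ?_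
    have : ContMDiffAt I (I.prod 𝓘(ℝ)) ∞ (fun m ↦ TotalSpace.mk' ℝ (E := Bundle.Trivial M ℝ) m
        (η.val m (e.symm m u) (e.symm m v))) x₀ :=
      ContMDiffAt.clm_bundle_apply₂ (F₁ := E) (F₂ := E) η.smooth.contMDiffAt (hsymm u) (hsymm v)
    refine (contMDiffAt_totalSpace.1 this).2.congr_of_eventuallyEq ?_
    filter_upwards [e.open_baseSet.mem_nhds hx₀] with x hx
    exact N_apply hx u v
  have hinv {x : M} (hx : x ∈ e.baseSet) : (N x).IsInvertible := by
    have hinj : Function.Injective (N x : E →ₗ[ℝ] E →L[ℝ] ℝ) := by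
      rw [← LinearMap.ker_eq_bot, LinearMap.ker_eq_bot']
      intro u hu
      have h0 : e.symm x u = 0 := by
        refine η.nondegenerate x _ fun v ↦ ?_
        have := congrArg (fun φ : E →L[ℝ] ℝ ↦ φ (e ⟨x, v⟩).2) hu
        simpa [N_apply hx, hx] using this
      rw [← e.symmL_apply (R := ℝ) hx] at h0
      have := congrArg (e.continuousLinearMapAt ℝ x) h0
      rwa [e.continuousLinearMapAt_symmL hx, map_zero] at this
    have hrank : Module.finrank ℝ E = Module.finrank ℝ (E →L[ℝ] ℝ) := by
      rw [← LinearEquiv.finrank_eq (LinearMap.toContinuousLinearMap (𝕜 := ℝ) (E := E) (F' := ℝ))]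
      exact (Subspace.dual_finrank_eq (K := ℝ) (V := E)).symm
    exact ⟨(LinearEquiv.ofInjectiveOfFinrankEq _ hinj hrank).toContinuousLinearEquiv, by ext; rfl⟩
  have hy {x : M} (hx : x ∈ e.baseSet) : e.symm x (e ⟨x, V x⟩).2 = V x := by
    simp [hx]
  have hr : ContMDiffAt I 𝓘(ℝ, E →L[ℝ] ℝ) ∞ (fun x ↦ N x (e ⟨x, V x⟩).2) x₀ := by
    refine contMDiffAt_clm_of_forall_apply fun u ↦ ?_
    obtain ⟨Z, hZ, hZu⟩ := exists_isSmoothSection_eventuallyEq e.open_baseSet hx₀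
      (contMDiffOn_trivialization_symm x₀ u)
    refine (hV Z hZ).contMDiffAt.congr_of_eventuallyEq ?_
    filter_upwards [hZu, e.open_baseSet.mem_nhds hx₀] with x h1 h2
    rw [N_apply h2, hy h2, h1]
  rw [Bundle.contMDiffAt_section]
  have h1 : ContMDiffAt I 𝓘(ℝ, (E →L[ℝ] ℝ) →L[ℝ] E) ∞
      (fun x ↦ ContinuousLinearMap.inverse (N x)) x₀ :=
    (hinv hx₀).contDiffAt_map_inverse.contMDiffAt.comp x₀ hN
  refine (h1.clm_apply hr).congr_of_eventuallyEq ?_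
  filter_upwards [e.open_baseSet.mem_nhds hx₀] with x hx
  obtain ⟨A, hA⟩ := hinv hx
  rw [← hA, ContinuousLinearMap.inverse_equiv]
  simp [he]

/-- The derivative of a smooth function along a smooth vector field is smooth. -/
theorem contMDiff_mvfderiv_apply {f : M → ℝ} (hf : ContMDiff I 𝓘(ℝ, ℝ) ∞ f)
    {X : Π x : M, TangentSpace I x} (hX : IsSmoothSection I E X) :
    ContMDiff I 𝓘(ℝ, ℝ) ∞ (fun x ↦ mvfderiv I f x (X x)) := by
  have h1 : ContMDiff I.tangent 𝓘(ℝ, ℝ).tangent ∞ (tangentMap I 𝓘(ℝ, ℝ) f) :=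
    hf.contMDiff_tangentMap (by simp)
  exact (contMDiff_snd_tangentBundle_modelSpace ℝ 𝓘(ℝ, ℝ)).comp (h1.comp hX)

/-- The Lie bracket of smooth vector fields is smooth. -/
theorem isSmoothSection_mlieBracket [FiniteDimensional ℝ E] {X Y : Π x : M, TangentSpace I x}
    (hX : IsSmoothSection I E X) (hY : IsSmoothSection I E Y) :
    IsSmoothSection I E (mlieBracket I X Y) := by
  have : CompleteSpace E := FiniteDimensional.complete ℝ E
  have : IsManifold I (minSmoothness ℝ 2) M := by
    rw [minSmoothness_of_isRCLikeNormedField]; infer_instance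
  have : IsManifold I (((⊤ : ℕ∞) : ℕ∞ω) + 1) M := ‹IsManifold I ∞ M›
  exact ContDiff.mlieBracket_vectorField (m := ⊤) (n := ⊤) hX hY (by simp)

theorem contMDiff_tensor2_apply {g : Π x : M, Tensor2 I x} (hg : SmoothTensor2 g)
    {X Y : Π x : M, TangentSpace I x} (hX : IsSmoothSection I E X) (hY : IsSmoothSection I E Y) :
    ContMDiff I 𝓘(ℝ, ℝ) ∞ (fun x ↦ g x (X x) (Y x)) := by
  have : ContMDiff I (I.prod 𝓘(ℝ)) ∞ (fun m ↦ TotalSpace.mk' ℝ (E := Bundle.Trivial M ℝ) m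
      (g m (X m) (Y m))) := fun x ↦
    ContMDiffAt.clm_bundle_apply₂ (F₁ := E) (F₂ := E) hg.contMDiffAt hX.contMDiffAt hY.contMDiffAt
  exact fun x ↦ (contMDiffAt_totalSpace.1 (this x)).2

theorem IsSmoothSection.mdiffAt {X : Π x : M, TangentSpace I x} (hX : IsSmoothSection I E X)
    (x : M) : MDiffAt (T% X) x :=
  hX.mdifferentiable (by simp) x

/-! ### Smooth three-forms -/

theorem ThreeForm.swap_right (T : ThreeForm I M) (x : M) (u v w : TangentSpace I x) :
    T.val x u v w = - T.val x u w v := alternating_swap (T.alt_right x u) v w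

section

variable [FiniteDimensional ℝ E]

theorem TwoForm.d_self_left (b : TwoForm I M) (x : M) (u v : TangentSpace I x) :
    b.d x u u v = 0 := by
  have hu := mdifferentiableAt_extend I E u
  have hv := mdifferentiableAt_extend I E v
  have h := b.d_apply hu hu hv
  simp only [extend_apply_self] at h
  -- The terms of the invariant formula cancel in pairs, by antisymmetry of `b` and of the bracket.
  rw [h, dTwoFormFun, mlieBracket_swap_apply (V := extend E v)]
  have h1 : (fun y ↦ b.val y (extend E v y) (extend E u y))
      = -fun y ↦ b.val y (extend E u y) (extend E v y) :=
    funext fun y ↦ alternating_swap (b.alt y) _ _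
  have h2 : mlieBracket I (extend E u) (extend E u) x = 0 := by
    have h3 : (2 : ℝ) • mlieBracket I (extend E u) (extend E u) x = 0 := by
      rw [two_smul, ← eq_neg_iff_add_eq_zero]
      exact mlieBracket_swap_apply
    exact (smul_eq_zero.1 h3).resolve_left two_ne_zero
  have h3 : (fun y ↦ b.val y (extend E u y) (extend E u y)) = fun _ ↦ 0 :=
    funext fun y ↦ b.alt y _
  rw [h1, h2, h3, mvfderiv_neg, mvfderiv_const]
  simp

theorem TwoForm.d_cyclic (b : TwoForm I M) (x : M) (u v w : TangentSpace I x) :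
    b.d x u v w = b.d x v w u := by
  have hu := mdifferentiableAt_extend I E u
  have hv := mdifferentiableAt_extend I E v
  have hw := mdifferentiableAt_extend I E w
  have h1 := b.d_apply hu hv hw
  have h2 := b.d_apply hv hw hu
  rw [← dTwoFormFun_cyclic] at h2
  simpa only [extend_apply_self] using h1.trans h2.symm

/-- The exterior derivative of a smooth `2`-form, as a smooth `3`-form. -/
def TwoForm.dThreeForm (b : TwoForm I M) : ThreeForm I M where
  val := b.d
  alt_left := b.d_self_left
  alt_right x u v := by rw [b.d_cyclic, b.d_self_left]
  smooth X Y Z hX hY hZ := by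
    simp only [fun x ↦ b.d_apply (hX.mdiffAt x) (hY.mdiffAt x) (hZ.mdiffAt x), dTwoFormFun]
    have h {V W : Π x : M, TangentSpace I x} (hV : IsSmoothSection I E V)
        (hW : IsSmoothSection I E W) : ContMDiff I 𝓘(ℝ, ℝ) ∞ (fun x ↦ b.val x (V x) (W x)) :=
      contMDiff_tensor2_apply b.smooth hV hW
    exact (((((contMDiff_mvfderiv_apply (h hY hZ) hX).add
      (contMDiff_mvfderiv_apply (h hZ hX) hY)).add (contMDiff_mvfderiv_apply (h hX hY) hZ)).sub
      (h (isSmoothSection_mlieBracket hX hY) hZ)).sub (h (isSmoothSection_mlieBracket hY hZ) hX)).sub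
      (h (isSmoothSection_mlieBracket hZ hX) hY)

/-- The smooth `3`-form `ε (H + db)`. -/
def twistThreeForm (b : TwoForm I M) (H : ThreeForm I M) (ε : ℤˣ) : ThreeForm I M where
  val := twistForm b H ε
  alt_left x u v := by simp [twistForm, H.alt_left, b.d_self_left]
  alt_right x u v := by
    have h : b.d x u v v = 0 := b.dThreeForm.alt_right x u v
    simp [twistForm, H.alt_right, h]
  smooth X Y Z hX hY hZ := by
    have := (contMDiff_const (c := ((ε : ℤ) : ℝ))).mul
      ((H.smooth X Y Z hX hY hZ).add (b.dThreeForm.smooth X Y Z hX hY hZ))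
    exact this

/-! ### The D-bracket -/

variable (η : PseudoRiemannianMetric I M)

/-- The D-bracket in terms of derivatives of `η` and Lie brackets: the Koszul formula eliminates
the Levi-Civita connection. -/
theorem val_twistedDBracket_eq_koszul (T : Π x : M, Tensor3 I x) {X Y Z : Π x : M, TangentSpace I x}
    {x : M} (hX : MDiffAt (T% X) x) (hY : MDiffAt (T% Y) x) (hZ : MDiffAt (T% Z) x) :
    η.val x (twistedDBracket η T X Y x) (Z x)
      = 1 / 2 * (mvfderiv I (fun y ↦ η.val y (Y y) (Z y)) x (X x)
        - mvfderiv I (fun y ↦ η.val y (X y) (Z y)) x (Y x)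
        + mvfderiv I (fun y ↦ η.val y (X y) (Y y)) x (Z x)
        + η.val x (mlieBracket I X Y x) (Z x) - η.val x (mlieBracket I X Z x) (Y x)
        + η.val x (mlieBracket I Y Z x) (X x) + T x (X x) (Y x) (Z x)) := by
  have hη := isLeviCivita_leviCivita η
  rw [val_twistedDBracket, hη.metric X Y Z x hY hZ, hη.metric Y X Z x hX hZ,
    hη.metric Z X Y x hX hY, ← hη.torsion_eq_zero X Y x hX hY, ← hη.torsion_eq_zero X Z x hX hZ,
    ← hη.torsion_eq_zero Y Z x hY hZ]
  simp only [map_sub, sub_apply]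
  rw [η.symm x (Y x), η.symm x (X x), η.symm x (X x)]
  ring

theorem isSmoothSection_twistedDBracket [T2Space M] (T : ThreeForm I M)
    {X Y : Π x : M, TangentSpace I x} (hX : IsSmoothSection I E X) (hY : IsSmoothSection I E Y) :
    IsSmoothSection I E (twistedDBracket η T.val X Y) := by
  refine η.isSmoothSection_of_val fun Z hZ ↦ ?_
  simp only [fun x ↦ val_twistedDBracket_eq_koszul η T.val (hX.mdiffAt x) (hY.mdiffAt x)
    (hZ.mdiffAt x)]
  have h {V W : Π x : M, TangentSpace I x} (hV : IsSmoothSection I E V)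
      (hW : IsSmoothSection I E W) : ContMDiff I 𝓘(ℝ, ℝ) ∞ (fun x ↦ η.val x (V x) (W x)) :=
    contMDiff_tensor2_apply η.smooth hV hW
  exact contMDiff_const.mul (((((((contMDiff_mvfderiv_apply (h hY hZ) hX).sub
    (contMDiff_mvfderiv_apply (h hX hZ) hY)).add (contMDiff_mvfderiv_apply (h hX hY) hZ)).add
    (h (isSmoothSection_mlieBracket hX hY) hZ)).sub (h (isSmoothSection_mlieBracket hX hZ) hY)).add
    (h (isSmoothSection_mlieBracket hY hZ) hX)).add (T.smooth X Y Z hX hY hZ))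

theorem twistedDBracket_add_left (T : Π x : M, Tensor3 I x) {X X' : Π x : M, TangentSpace I x}
    (Y : Π x : M, TangentSpace I x) {x : M} (hX : MDiffAt (T% X) x) (hX' : MDiffAt (T% X') x) :
    twistedDBracket η T (X + X') Y x = twistedDBracket η T X Y x + twistedDBracket η T X' Y x := by
  refine η.ext_diff fun Z _ ↦ ?_
  simp only [map_add, add_apply, val_twistedDBracket, map_sub, sub_apply,
    (leviCivita η).isCovariantDerivativeOn.add hX hX', Pi.add_apply]
  ring

theorem twistedDBracket_add_right (T : Π x : M, Tensor3 I x) (X : Π x : M, TangentSpace I x)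
    {Y Y' : Π x : M, TangentSpace I x} {x : M} (hY : MDiffAt (T% Y) x) (hY' : MDiffAt (T% Y') x) :
    twistedDBracket η T X (Y + Y') x = twistedDBracket η T X Y x + twistedDBracket η T X Y' x := by
  refine η.ext_diff fun Z _ ↦ ?_
  simp only [map_add, add_apply, val_twistedDBracket, map_sub, sub_apply,
    (leviCivita η).isCovariantDerivativeOn.add hY hY', Pi.add_apply]
  ring

theorem twistedDBracket_const_smul_left (T : Π x : M, Tensor3 I x) (c : ℝ)
    {X : Π x : M, TangentSpace I x} (Y : Π x : M, TangentSpace I x) {x : M}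
    (hX : MDiffAt (T% X) x) :
    twistedDBracket η T (c • X) Y x = c • twistedDBracket η T X Y x := by
  refine η.ext_diff fun Z _ ↦ ?_
  simp only [map_smul, smul_apply, val_twistedDBracket, map_sub, sub_apply,
    (leviCivita η).isCovariantDerivativeOn.smul_const c hX, Pi.smul_apply, smul_eq_mul]
  ring

/-- The derivation property of the D-bracket in its second argument. -/
theorem twistedDBracket_smul_right (T : Π x : M, Tensor3 I x) (X : Π x : M, TangentSpace I x)
    {Y : Π x : M, TangentSpace I x} {f : M → ℝ} {x : M} (hf : MDiffAt f x)
    (hY : MDiffAt (T% Y) x) :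
    twistedDBracket η T X (f • Y) x
      = f x • twistedDBracket η T X Y x + mvfderiv I f x (X x) • Y x := by
  refine η.ext_diff fun Z _ ↦ ?_
  simp only [map_smul, smul_apply, val_twistedDBracket, map_sub, sub_apply, map_add, add_apply,
    (leviCivita η).isCovariantDerivativeOn.leibniz hY hf, Pi.smul_apply', smul_eq_mul,
    ContinuousLinearMap.smulRight_apply]
  ring

theorem mvfderiv_val_eq_twistedDBracket (T : ThreeForm I M) (X : Π x : M, TangentSpace I x)
    {Y Z : Π x : M, TangentSpace I x} {x : M} (hY : MDiffAt (T% Y) x) (hZ : MDiffAt (T% Z) x) :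
    mvfderiv I (fun y ↦ η.val y (Y y) (Z y)) x (X x)
      = η.val x (twistedDBracket η T.val X Y x) (Z x)
        + η.val x (Y x) (twistedDBracket η T.val X Z x) := by
  rw [(isLeviCivita_leviCivita η).metric X Y Z x hY hZ, η.symm x (Y x) (twistedDBracket ..),
    val_twistedDBracket, val_twistedDBracket, T.swap_right, η.symm x (Y x)]
  simp only [map_sub, sub_apply]
  ring

theorem val_twistedDBracket_self (T : ThreeForm I M) {X : Π x : M, TangentSpace I x}
    (Z : Π x : M, TangentSpace I x) {x : M} (hX : MDiffAt (T% X) x) :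
    η.val x (twistedDBracket η T.val X X x) (Z x)
      = 1 / 2 * mvfderiv I (fun y ↦ η.val y (X y) (X y)) x (Z x) := by
  rw [(isLeviCivita_leviCivita η).metric Z X X x hX hX, val_twistedDBracket, T.alt_left,
    η.symm x (X x)]
  simp only [map_sub, sub_apply]
  ring

/-- The tangent bundle with the D-bracket twisted by a smooth `3`-form is a metric algebroid. -/
theorem isMetricAlgebroid_tangentAlgebroid [T2Space M] (T : ThreeForm I M) :
    (tangentAlgebroid η T.val).IsMetricAlgebroid E where
  isSmoothSubbundle x₀ := by
    set e := trivializationAt E (TangentSpace I : M → Type _) x₀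
    have h := e.isLocalFrameOn_localFrame_baseSet I ∞ (Module.finBasis ℝ E)
    refine ⟨e.baseSet, e.open_baseSet.mem_nhds (FiberBundle.mem_baseSet_trivializationAt' x₀),
      _, e.localFrame (Module.finBasis ℝ E), h.contMDiffOn, fun x hx ↦ ⟨h.linearIndependent hx, ?_⟩⟩
    exact top_le_iff.1 (h.generating hx)
  bracket_smooth _ _ h₁ h₂ := isSmoothSection_twistedDBracket η T h₁ h₂
  pairing_smooth _ _ h₁ h₂ := contMDiff_tensor2_apply η.smooth h₁ h₂
  anchor_smooth _ h := h
  bracket_add_left _ _ e₃ h₁ h₂ _ := funext fun x ↦ Subtype.ext <|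
    twistedDBracket_add_left η T.val (fun y ↦ (e₃ y : TangentSpace I y))
      (IsSmoothSection.mdiffAt h₁ x) (IsSmoothSection.mdiffAt h₂ x)
  bracket_add_right e₁ _ _ _ h₂ h₃ := funext fun x ↦ Subtype.ext <|
    twistedDBracket_add_right η T.val (fun y ↦ (e₁ y : TangentSpace I y))
      (IsSmoothSection.mdiffAt h₂ x) (IsSmoothSection.mdiffAt h₃ x)
  bracket_smul_left c _ e₂ h₁ _ := funext fun x ↦ Subtype.ext <|
    twistedDBracket_const_smul_left η T.val c (fun y ↦ (e₂ y : TangentSpace I y))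
      (IsSmoothSection.mdiffAt h₁ x)
  bracket_smul_right c e₁ e₂ _ h₂ := funext fun x ↦ Subtype.ext <| by
    have := twistedDBracket_smul_right η T.val (fun y ↦ (e₁ y : TangentSpace I y))
      (f := fun _ ↦ c) mdifferentiableAt_const (IsSmoothSection.mdiffAt h₂ x)
    rw [mvfderiv_const, zero_apply, zero_smul, add_zero] at this
    exact this
  leibniz f e₁ e₂ hf _ h₂ x := Subtype.ext <|
    twistedDBracket_smul_right η T.val (fun y ↦ (e₁ y : TangentSpace I y))
      (hf.mdifferentiable (by simp) x) (IsSmoothSection.mdiffAt h₂ x)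
  pairing_symm x u v := η.symm x u v
  pairing_nondegenerate x u h := Subtype.ext <|
    η.nondegenerate x u fun v ↦ h ⟨v, Submodule.mem_top⟩
  pairing_bracket e _ _ _ h₁ h₂ x :=
    mvfderiv_val_eq_twistedDBracket η T (fun y ↦ (e y : TangentSpace I y))
      (IsSmoothSection.mdiffAt h₁ x) (IsSmoothSection.mdiffAt h₂ x)
  pairing_bracket_self _ e₁ h _ x :=
    val_twistedDBracket_self η T (fun y ↦ (e₁ y : TangentSpace I y)) (IsSmoothSection.mdiffAt h x)

end

/-! ### Transport along an isomorphism -/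

section

variable {F : Type*} [NormedAddCommGroup F] [NormedSpace ℝ F] {V : M → Type*}
  [TopologicalSpace (TotalSpace F V)] [∀ x, TopologicalSpace (V x)] [∀ x, AddCommGroup (V x)]
  [∀ x, Module ℝ (V x)] [FiberBundle F V] [VectorBundle ℝ F V]
  {F' : Type*} [NormedAddCommGroup F'] [NormedSpace ℝ F'] {V' : M → Type*}
  [TopologicalSpace (TotalSpace F' V')] [∀ x, TopologicalSpace (V' x)] [∀ x, AddCommGroup (V' x)]
  [∀ x, Module ℝ (V' x)] [FiberBundle F' V']

/-- A smooth subbundle with structure maps that is isomorphic to a metric algebroid is itself a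
metric algebroid. -/
theorem AlgebroidData.IsIso.isMetricAlgebroid {A : AlgebroidData I V} {A' : AlgebroidData I V'}
    {ψ : Π x, A.fiber x ≃ₗ[ℝ] A'.fiber x} (h : AlgebroidData.IsIso F F' A A' ψ)
    (hA' : A'.IsMetricAlgebroid F') (hA : IsSmoothSubbundle I F A.fiber) :
    A.IsMetricAlgebroid F := by
  have hb {e₁ e₂ : Π x, A.fiber x} (h₁ : A.IsSmooth F e₁) (h₂ : A.IsSmooth F e₂) (x : M) :
      ψ x (A.bracket e₁ e₂ x) = A'.bracket (fun x ↦ ψ x (e₁ x)) (fun x ↦ ψ x (e₂ x)) x :=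
    congrFun (h.bracket e₁ e₂ h₁ h₂) x
  have hadd {e₁ e₂ : Π x, A.fiber x} (h₁ : A.IsSmooth F e₁) (h₂ : A.IsSmooth F e₂) :
      A.IsSmooth F (e₁ + e₂) := ContMDiff.add_section (I := I) (F := F) h₁ h₂
  have hsmul {f : M → ℝ} {e : Π x, A.fiber x} (hf : ContMDiff I 𝓘(ℝ, ℝ) ∞ f)
      (he : A.IsSmooth F e) : A.IsSmooth F (fun x ↦ f x • e x) :=
    ContMDiff.smul_section (I := I) (F := F) hf he
  have hpair (e₁ e₂ : Π x, A.fiber x) : (fun x ↦ A.pairing x (e₁ x) (e₂ x))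
      = fun x ↦ A'.pairing x (ψ x (e₁ x)) (ψ x (e₂ x)) := funext fun x ↦ (h.isometry x _ _).symm
  constructor
  · exact hA
  · intro e₁ e₂ h₁ h₂
    have := h.symm_smooth _ (hA'.bracket_smooth _ _ (h.smooth e₁ h₁) (h.smooth e₂ h₂))
    simpa only [← hb h₁ h₂, LinearEquiv.symm_apply_apply] using this
  · intro e₁ e₂ h₁ h₂
    rw [hpair]
    exact hA'.pairing_smooth _ _ (h.smooth e₁ h₁) (h.smooth e₂ h₂)
  · intro e he
    simpa only [h.anchor] using hA'.anchor_smooth _ (h.smooth e he)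
  · intro e₁ e₂ e₃ h₁ h₂ h₃
    ext1 x
    apply (ψ x).injective
    have := congrFun (hA'.bracket_add_left _ _ _ (h.smooth e₁ h₁) (h.smooth e₂ h₂)
      (h.smooth e₃ h₃)) x
    rw [hb (hadd h₁ h₂) h₃, Pi.add_apply, map_add, hb h₁ h₃, hb h₂ h₃]
    simp only [Pi.add_apply, map_add]
    exact this
  · intro e₁ e₂ e₃ h₁ h₂ h₃
    ext1 x
    apply (ψ x).injective
    have := congrFun (hA'.bracket_add_right _ _ _ (h.smooth e₁ h₁) (h.smooth e₂ h₂)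
      (h.smooth e₃ h₃)) x
    rw [hb h₁ (hadd h₂ h₃), Pi.add_apply, map_add, hb h₁ h₂, hb h₁ h₃]
    simp only [Pi.add_apply, map_add]
    exact this
  · intro c e₁ e₂ h₁ h₂
    ext1 x
    apply (ψ x).injective
    have := congrFun (hA'.bracket_smul_left c _ _ (h.smooth e₁ h₁) (h.smooth e₂ h₂)) x
    rw [hb (e₁ := c • e₁) (hsmul contMDiff_const h₁) h₂, Pi.smul_apply, map_smul, hb h₁ h₂]
    simp only [Pi.smul_apply, map_smul]
    exact this
  · intro c e₁ e₂ h₁ h₂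
    ext1 x
    apply (ψ x).injective
    have := congrFun (hA'.bracket_smul_right c _ _ (h.smooth e₁ h₁) (h.smooth e₂ h₂)) x
    rw [hb (e₂ := c • e₂) h₁ (hsmul contMDiff_const h₂), Pi.smul_apply, map_smul, hb h₁ h₂]
    simp only [Pi.smul_apply, map_smul]
    exact this
  · intro f e₁ e₂ hf h₁ h₂ x
    apply (ψ x).injective
    have := hA'.leibniz f _ _ hf (h.smooth e₁ h₁) (h.smooth e₂ h₂) x
    rw [hb h₁ (hsmul hf h₂), map_add, map_smul, map_smul, hb h₁ h₂, ← h.anchor]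
    simp only [map_smul]
    exact this
  · intro x u v
    rw [← h.isometry, hA'.pairing_symm, h.isometry]
  · intro x u hu
    refine (ψ x).map_eq_zero_iff.1 (hA'.pairing_nondegenerate x _ fun v ↦ ?_)
    have := h.isometry x u ((ψ x).symm v)
    rwa [LinearEquiv.apply_symm_apply, hu] at this
  · intro e e₁ e₂ he h₁ h₂ x
    rw [hpair, ← h.anchor, ← h.isometry, ← h.isometry, hb he h₁, hb he h₂]
    exact hA'.pairing_bracket _ _ _ (h.smooth e he) (h.smooth e₁ h₁) (h.smooth e₂ h₂) x
  · intro e e₁ he h₁ x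
    rw [hpair, ← h.anchor, ← h.isometry, hb he he]
    exact hA'.pairing_bracket_self _ _ (h.smooth e he) (h.smooth e₁ h₁) x

end

/-! ### The eigenbundles as graphs -/

section

variable (η : PseudoRiemannianMetric I M) (b : TwoForm I M) (ε : ℤˣ)

/-- The element of `C_ε` over the tangent vector `v`. -/
def graphVector (x : M) (v : TangentSpace I x) : GenTangent I x :=
  (v, b.val x v + ((ε : ℤ) : ℝ) • η.val x v)

theorem genPairing_graphVector (x : M) (u v : TangentSpace I x) :
    genPairing I x (graphVector η b ε x u) (graphVector η b ε x v)
      = 2 * ((ε : ℤ) : ℝ) * η.val x u v := by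
  simp only [genPairing, LinearMap.mk₂_apply, graphVector, add_apply, smul_apply, smul_eq_mul]
  rw [alternating_swap (b.alt x) v u, η.symm x v u]
  ring

/-- The graphs for opposite signs are orthogonal to each other. -/
theorem genPairing_graphVector_neg (x : M) (u v : TangentSpace I x) :
    genPairing I x (graphVector η b (-ε) x u) (graphVector η b ε x v) = 0 := by
  simp only [genPairing, LinearMap.mk₂_apply, graphVector, add_apply, smul_apply, smul_eq_mul]
  rw [alternating_swap (b.alt x) v u, η.symm x v u]
  push_cast
  ring

theorem units_int_cast_mul_self (ε : ℤˣ) : ((ε : ℤ) : ℝ) * ((ε : ℤ) : ℝ) = 1 := by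
  rcases Int.units_eq_one_or ε with h | h <;> simp [h]

variable [FiniteDimensional ℝ E]

theorem mem_eigenbundle_iff {x : M} {u : GenTangent I x} :
    u ∈ eigenbundle η b ε x ↔ u.2 = b.val x u.1 + ((ε : ℤ) : ℝ) • η.val x u.1 := by
  have hε := units_int_cast_mul_self ε
  have h : genMetric η b x u = (η.sharp x (u.2 - b.val x u.1),
      η.flat x u.1 + b.val x (η.sharp x (u.2 - b.val x u.1))) := by
    refine Prod.ext ?_ ?_ <;> simp [genMetric, genMetricZero, bPlus, sub_eq_add_neg]
  rw [eigenbundle, Module.End.mem_eigenspace_iff, h]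
  generalize ((ε : ℤ) : ℝ) = c at hε
  constructor
  · intro h
    have h1 : η.sharp x (u.2 - b.val x u.1) = c • u.1 := congrArg Prod.fst h
    rw [LinearEquiv.symm_apply_eq, map_smul] at h1
    exact eq_add_of_sub_eq' h1
  · intro h
    have h1 : η.sharp x (u.2 - b.val x u.1) = c • u.1 := by
      rw [h, LinearEquiv.symm_apply_eq, map_smul, add_sub_cancel_left]
      rfl
    refine Prod.ext h1 ?_
    change η.val x u.1 + b.val x (η.sharp x (u.2 - b.val x u.1)) = c • u.2
    rw [h1, h, map_smul, smul_add, smul_smul, hε, one_smul, add_comm]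

theorem graphVector_mem (x : M) (v : TangentSpace I x) :
    graphVector η b ε x v ∈ eigenbundle η b ε x := (mem_eigenbundle_iff η b ε).2 rfl

theorem graphVector_fst {x : M} {u : GenTangent I x} (hu : u ∈ eigenbundle η b ε x) :
    graphVector η b ε x u.1 = u := Prod.ext rfl ((mem_eigenbundle_iff η b ε).1 hu).symm

/-- The anchor of `C_ε`, as a linear isomorphism onto the tangent space. -/
def eigenbundleEquiv (x : M) :
    eigenbundle η b ε x ≃ₗ[ℝ] (⊤ : Submodule ℝ (TangentSpace I x)) where
  toFun u := ⟨(u : GenTangent I x).1, Submodule.mem_top⟩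
  map_add' _ _ := rfl
  map_smul' _ _ := rfl
  invFun v := ⟨graphVector η b ε x v, graphVector_mem η b ε x v⟩
  left_inv u := Subtype.ext (graphVector_fst η b ε u.2)
  right_inv _ := rfl

/-- As `C_{-ε}` is orthogonal to `C_ε`, the projection of `u` to `C_ε` is determined by the pairings
of `u` with `C_ε`. -/
theorem eigenProjection_eq_graphVector {x : M} {u : GenTangent I x} {v : TangentSpace I x}
    (h : ∀ z, genPairing I x u (graphVector η b ε x z) = 2 * ((ε : ℤ) : ℝ) * η.val x v z) :
    (eigenProjection η b ε x u : GenTangent I x) = graphVector η b ε x v := by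
  have hε := units_int_cast_mul_self ε
  obtain ⟨w, hw, w', hw', rfl⟩ := Submodule.mem_sup.1
    ((isCompl_eigenbundle η b ε x).sup_eq_top ▸ Submodule.mem_top : u ∈ _ ⊔ _)
  have h1 : (eigenProjection η b ε x (w + w') : GenTangent I x) = w := by
    rw [eigenProjection, map_add, Submodule.projectionOnto_apply_of_mem_left _ hw,
      (Submodule.projectionOnto_apply_eq_zero_iff _).2 hw', add_zero]
  rw [h1, ← graphVector_fst η b ε hw]
  congr 1
  rw [← sub_eq_zero]
  refine η.nondegenerate x _ fun z ↦ ?_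
  have h2 := h z
  rw [← graphVector_fst η b ε hw, ← graphVector_fst η b (-ε) hw', map_add, LinearMap.add_apply,
    genPairing_graphVector, genPairing_graphVector_neg, add_zero, mul_assoc, mul_assoc] at h2
  have h3 := congrArg (((ε : ℤ) : ℝ) * ·) (mul_left_cancel₀ two_ne_zero h2)
  simp only [← mul_assoc, hε, one_mul] at h3
  rw [map_sub, sub_apply, h3, sub_self]

end

/-! ### Smooth sections of the eigenbundles -/

section

variable (η : PseudoRiemannianMetric I M) (b : TwoForm I M) (ε : ℤˣ)

/-- Smoothness of a section of `TM ⊕ T*M` at a point is smoothness of both components. -/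
theorem contMDiffAt_genTangent_iff {ξ : Π x : M, GenTangent I x} {x₀ : M} :
    ContMDiffAt I (I.prod 𝓘(ℝ, E × (E →L[ℝ] ℝ))) ∞
      (fun x ↦ TotalSpace.mk' (E × (E →L[ℝ] ℝ)) (E := fun x : M ↦ GenTangent I x) x (ξ x)) x₀ ↔
    ContMDiffAt I (I.prod 𝓘(ℝ, E)) ∞ (fun x ↦ TotalSpace.mk' E x (ξ x).1) x₀ ∧
      ContMDiffAt I (I.prod 𝓘(ℝ, E →L[ℝ] ℝ)) ∞
        (fun x ↦ TotalSpace.mk' (E →L[ℝ] ℝ) (E := fun x : M ↦ Cotangent I x) x (ξ x).2) x₀ := by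
  rw [Bundle.contMDiffAt_section, Bundle.contMDiffAt_section, Bundle.contMDiffAt_section]
  exact contMDiffAt_prod_module_iff _

theorem contMDiffAt_tensor2_apply_left {g : Π x : M, Tensor2 I x} (hg : SmoothTensor2 g)
    {X : Π x : M, TangentSpace I x} {x₀ : M} (hX : CMDiffAt ∞ (T% X) x₀) :
    ContMDiffAt I (I.prod 𝓘(ℝ, E →L[ℝ] ℝ)) ∞
      (fun x ↦ TotalSpace.mk' (E →L[ℝ] ℝ) (E := fun x : M ↦ Cotangent I x) x (g x (X x))) x₀ :=
  ContMDiffAt.clm_bundle_apply (F₁ := E) (F₂ := E →L[ℝ] ℝ) hg.contMDiffAt hX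

theorem contMDiffAt_graphVector_snd {X : Π x : M, TangentSpace I x} {x₀ : M}
    (hX : CMDiffAt ∞ (T% X) x₀) :
    ContMDiffAt I (I.prod 𝓘(ℝ, E →L[ℝ] ℝ)) ∞ (fun x ↦ TotalSpace.mk' (E →L[ℝ] ℝ)
      (E := fun x : M ↦ Cotangent I x) x (graphVector η b ε x (X x)).2) x₀ :=
  (contMDiffAt_tensor2_apply_left b.smooth hX).add_section
    (contMDiffAt_tensor2_apply_left η.smooth hX).const_smul_section

theorem contMDiffAt_graphVector {X : Π x : M, TangentSpace I x} {x₀ : M}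
    (hX : CMDiffAt ∞ (T% X) x₀) :
    ContMDiffAt I (I.prod 𝓘(ℝ, E × (E →L[ℝ] ℝ))) ∞ (fun x ↦ TotalSpace.mk' (E × (E →L[ℝ] ℝ))
      (E := fun x : M ↦ GenTangent I x) x (graphVector η b ε x (X x))) x₀ :=
  contMDiffAt_genTangent_iff.2 ⟨hX, contMDiffAt_graphVector_snd η b ε hX⟩

section

variable [FiniteDimensional ℝ E]

/-- `C_ε` is a smooth subbundle: the graphs of a local frame of the tangent bundle form a local
frame. -/
theorem isSmoothSubbundle_eigenbundle :
    IsSmoothSubbundle I (E × (E →L[ℝ] ℝ)) (eigenbundle (M := M) η b ε) := by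
  intro x₀
  set e := trivializationAt E (TangentSpace I : M → Type _) x₀
  have h := e.isLocalFrameOn_localFrame_baseSet I ∞ (Module.finBasis ℝ E)
  refine ⟨e.baseSet, e.open_baseSet.mem_nhds (FiberBundle.mem_baseSet_trivializationAt' x₀), _,
    fun i x ↦ graphVector η b ε x (e.localFrame (Module.finBasis ℝ E) i x), fun i x hx ↦
    (contMDiffAt_graphVector η b ε (h.contMDiffAt e.open_baseSet hx i)).contMDiffWithinAt,
    fun x hx ↦ ?_⟩
  let L : TangentSpace I x →ₗ[ℝ] GenTangent I x := (eigenbundle η b ε x).subtype ∘ₗ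
    (eigenbundleEquiv η b ε x).symm.toLinearMap ∘ₗ Submodule.topEquiv.symm.toLinearMap
  have hrange : L.range = eigenbundle η b ε x := by
    ext u
    exact ⟨fun ⟨v, hv⟩ ↦ hv ▸ graphVector_mem η b ε x v,
      fun hu ↦ ⟨u.1, graphVector_fst η b ε hu⟩⟩
  constructor
  · exact (h.linearIndependent hx).map' L
      (LinearMap.ker_eq_bot.2 fun u v huv ↦ congrArg Prod.fst huv)
  · have : (Set.range fun i ↦ graphVector η b ε x (e.localFrame (Module.finBasis ℝ E) i x))
        = L '' Set.range fun i ↦ e.localFrame (Module.finBasis ℝ E) i x := by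
      rw [← Set.range_comp]; rfl
    rw [this, Submodule.span_image, top_le_iff.1 (h.generating hx), Submodule.map_top, hrange]

end

/-! ### The bracket of the eigenbundles -/

theorem mvfderiv_graphVector_snd_apply {Y W : Π x : M, TangentSpace I x} {x : M}
    (hY : MDiffAt (T% Y) x) (hW : MDiffAt (T% W) x) :
    mvfderiv I (fun y ↦ (graphVector η b ε y (Y y)).2 (W y)) x
      = mvfderiv I (fun y ↦ b.val y (Y y) (W y)) x
        + ((ε : ℤ) : ℝ) • mvfderiv I (fun y ↦ η.val y (Y y) (W y)) x := by
  have hb := mdifferentiableAt_tensor2 b.smooth hY hW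
  have hη := mdifferentiableAt_tensor2 η.smooth hY hW
  have h1 := mvfderiv_smul (mdifferentiableAt_const (c := ((ε : ℤ) : ℝ))) hη
  rw [mvfderiv_const] at h1
  have h2 := mvfderiv_add hb (mdifferentiableAt_const (c := ((ε : ℤ) : ℝ)).smul hη)
  rw [h1] at h2
  exact h2.trans (by simp)

theorem dOneFormFun_graphVector {X Y Z : Π x : M, TangentSpace I x} {x : M}
    (hX : MDiffAt (T% X) x) (hY : MDiffAt (T% Y) x) (hZ : MDiffAt (T% Z) x) :
    dOneFormFun (fun y ↦ (graphVector η b ε y (Y y)).2) X Z x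
      = mvfderiv I (fun y ↦ b.val y (Y y) (Z y)) x (X x)
        - mvfderiv I (fun y ↦ b.val y (Y y) (X y)) x (Z x) - b.val x (Y x) (mlieBracket I X Z x)
        + ((ε : ℤ) : ℝ) * (mvfderiv I (fun y ↦ η.val y (Y y) (Z y)) x (X x)
        - mvfderiv I (fun y ↦ η.val y (Y y) (X y)) x (Z x)
        - η.val x (Y x) (mlieBracket I X Z x)) := by
  rw [dOneFormFun, mvfderiv_graphVector_snd_apply η b ε hY hZ,
    mvfderiv_graphVector_snd_apply η b ε hY hX]
  simp only [graphVector, add_apply, smul_apply, smul_eq_mul]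
  ring

variable [FiniteDimensional ℝ E]

/-- The pairing of the Dorfman bracket of two sections of `C_ε` with a third one. The terms with `η`
form the Koszul expression of the D-bracket, and the terms with `b` form `db`. -/
theorem genPairing_dorfman_graphVector (H : ThreeForm I M) {X Y Z : Π x : M, TangentSpace I x}
    (hX : IsSmoothSection I E X) (hY : IsSmoothSection I E Y) {x : M} (hZ : MDiffAt (T% Z) x) :
    genPairing I x (dorfman H (fun y ↦ graphVector η b ε y (X y))
        (fun y ↦ graphVector η b ε y (Y y)) x) (graphVector η b ε x (Z x))
      = 2 * ((ε : ℤ) : ℝ) * η.val x (twistedDBracket η (twistForm b H ε) X Y x) (Z x) := by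
  have hα {W : Π x : M, TangentSpace I x} (hW : IsSmoothSection I E W) :
      DiffCovectorAt (fun y ↦ (graphVector η b ε y (W y)).2) x :=
    (contMDiffAt_graphVector_snd η b ε hW.contMDiffAt).mdifferentiableAt (by simp)
  have hX' := hX.mdiffAt x
  have hY' := hY.mdiffAt x
  -- The factor `ε` of the twist cancels against that of the pairing, as `ε ^ 2 = 1`.
  have hε (K S : ℝ) : 2 * ((ε : ℤ) : ℝ) * (1 / 2 * (K + ((ε : ℤ) : ℝ) * S))
      = ((ε : ℤ) : ℝ) * K + S := by
    linear_combination S * units_int_cast_mul_self ε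
  have h1 : genPairing I x (dorfman H (fun y ↦ graphVector η b ε y (X y))
        (fun y ↦ graphVector η b ε y (Y y)) x) (graphVector η b ε x (Z x))
      = (graphVector η b ε x (Z x)).2 (mlieBracket I X Y x)
        + (dOneForm (fun y ↦ (graphVector η b ε y (Y y)).2) x (X x) (Z x)
        + mvfderiv I (fun y ↦ (graphVector η b ε y (Y y)).2 (X y)) x (Z x)
        - dOneForm (fun y ↦ (graphVector η b ε y (X y)).2) x (Y x) (Z x)
        + H.val x (X x) (Y x) (Z x)) := rfl
  rw [h1, dOneForm_apply (hα hY) hX' hZ, dOneForm_apply (hα hX) hY' hZ,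
    dOneFormFun_graphVector η b ε hX' hY' hZ, dOneFormFun_graphVector η b ε hY' hX' hZ,
    mvfderiv_graphVector_snd_apply η b ε hY' hX',
    val_twistedDBracket_eq_koszul η _ hX' hY' hZ]
  have hd : twistForm b H ε x (X x) (Y x) (Z x)
      = ((ε : ℤ) : ℝ) * (H.val x (X x) (Y x) (Z x) + dTwoFormFun b.val X Y Z x) := by
    rw [← b.d_apply hX' hY' hZ]; rfl
  have hbs {V W : Π x : M, TangentSpace I x} : mvfderiv I (fun y ↦ b.val y (V y) (W y)) x
      = - mvfderiv I (fun y ↦ b.val y (W y) (V y)) x := by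
    rw [← mvfderiv_neg]
    exact congrArg (mvfderiv I · x) (funext fun y ↦ alternating_swap (b.alt y) _ _)
  have hηs {V W : Π x : M, TangentSpace I x} : mvfderiv I (fun y ↦ η.val y (V y) (W y)) x
      = mvfderiv I (fun y ↦ η.val y (W y) (V y)) x :=
    congrArg (mvfderiv I · x) (funext fun y ↦ η.symm y _ _)
  rw [hd, hε, dTwoFormFun, mlieBracket_swap_apply (V := Z), hbs (V := Z), hηs (V := Y) (W := X),
    hbs (V := Y) (W := X)]
  simp only [graphVector, add_apply, smul_apply, smul_eq_mul, map_neg, neg_apply]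
  rw [alternating_swap (b.alt x) (mlieBracket I X Y x),
    alternating_swap (b.alt x) (mlieBracket I Y Z x),
    alternating_swap (b.alt x) (mlieBracket I X Z x), η.symm x (mlieBracket I X Y x),
    η.symm x (mlieBracket I X Z x), η.symm x (mlieBracket I Y Z x)]
  ring

/-- The bracket on `C_ε` corresponds under the anchor to the D-bracket twisted by `ε (H + db)`. -/
theorem eigenProjection_dorfman_graphVector (H : ThreeForm I M) {X Y : Π x : M, TangentSpace I x}
    (hX : IsSmoothSection I E X) (hY : IsSmoothSection I E Y) (x : M) :
    (eigenProjection η b ε x (dorfman H (fun y ↦ graphVector η b ε y (X y))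
        (fun y ↦ graphVector η b ε y (Y y)) x) : GenTangent I x)
      = graphVector η b ε x (twistedDBracket η (twistForm b H ε) X Y x) := by
  refine eigenProjection_eq_graphVector η b ε fun z ↦ ?_
  simpa using genPairing_dorfman_graphVector η b ε H hX hY (mdifferentiableAt_extend I E z)

/-- The anchor of `C_ε` is an isomorphism onto the tangent bundle with the twisted D-bracket. -/
theorem isIso_eigenbundleEquiv (H : ThreeForm I M) :
    AlgebroidData.IsIso (E × (E →L[ℝ] ℝ)) E (eigenAlgebroid η b H ε)
      (tangentAlgebroid η (twistForm b H ε)) (eigenbundleEquiv η b ε) where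
  smooth e he x := (contMDiffAt_genTangent_iff.1 (he x)).1
  symm_smooth e he x := contMDiffAt_graphVector η b ε (he x)
  anchor _ _ := rfl
  bracket e₁ e₂ h₁ h₂ := by
    ext1 x
    have hs {e : Π x, (eigenAlgebroid η b H ε).fiber x}
        (he : (eigenAlgebroid η b H ε).IsSmooth (E × (E →L[ℝ] ℝ)) e) :
        IsSmoothSection I E (fun x ↦ (e x : GenTangent I x).1) :=
      fun x ↦ (contMDiffAt_genTangent_iff.1 (he x)).1
    have hg (e : Π x, (eigenAlgebroid η b H ε).fiber x) :
        (fun y ↦ graphVector η b ε y (e y : GenTangent I y).1) = fun y ↦ (e y : GenTangent I y) :=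
      funext fun y ↦ graphVector_fst η b ε (e y).2
    have := eigenProjection_dorfman_graphVector η b ε H (hs h₁) (hs h₂) x
    rw [hg, hg] at this
    exact Subtype.ext (congrArg Prod.fst this)
  isometry x u v := by
    change η.val x (u : GenTangent I x).1 (v : GenTangent I x).1
      = ((ε : ℤ) : ℝ) * (1 / 2) * genPairing I x u v
    have h := genPairing_graphVector η b ε x (u : GenTangent I x).1 (v : GenTangent I x).1
    rw [graphVector_fst η b ε u.2, graphVector_fst η b ε v.2] at h
    rw [h]
    linear_combination (- η.val x (u : GenTangent I x).1 (v : GenTangent I x).1)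
      * units_int_cast_mul_self ε

end

end

end DoubledGeometry

theorem proposition5p2 {n : ℕ} {M : Type*} [TopologicalSpace M]
    [ChartedSpace (EuclideanSpace ℝ (Fin n)) M] [IsManifold (𝓡 n) ∞ M] [T2Space M]
    [SecondCountableTopology M]
    (η : PseudoRiemannianMetric (𝓡 n) M) (b : TwoForm (𝓡 n) M) (H : ThreeForm (𝓡 n) M) (ε : ℤˣ) :
    (∀ x : M, (eigenbundle η b ε x : Set (GenTangent (𝓡 n) x)) =
      Set.range fun v : TangentSpace (𝓡 n) x ↦ (v, b.val x v + ((ε : ℤ) : ℝ) • η.val x v)) ∧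
    (eigenAlgebroid η b H ε).IsMetricAlgebroid
      (EuclideanSpace ℝ (Fin n) × (EuclideanSpace ℝ (Fin n) →L[ℝ] ℝ)) ∧
    (tangentAlgebroid η (twistForm b H ε)).IsMetricAlgebroid (EuclideanSpace ℝ (Fin n)) ∧
    ∃ ψ : Π x : M, (eigenAlgebroid η b H ε).fiber x ≃ₗ[ℝ]
        (tangentAlgebroid η (twistForm b H ε)).fiber x,
      (∀ x u, (ψ x u : TangentSpace (𝓡 n) x) = (eigenAlgebroid η b H ε).anchor x u) ∧
      AlgebroidData.IsIso (EuclideanSpace ℝ (Fin n) × (EuclideanSpace ℝ (Fin n) →L[ℝ] ℝ))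
        (EuclideanSpace ℝ (Fin n)) (eigenAlgebroid η b H ε)
        (tangentAlgebroid η (twistForm b H ε)) ψ := by
  have hiso := isIso_eigenbundleEquiv η b ε H
  have htan : (tangentAlgebroid η (twistForm b H ε)).IsMetricAlgebroid
      (EuclideanSpace ℝ (Fin n)) := isMetricAlgebroid_tangentAlgebroid η (twistThreeForm b H ε)
  refine ⟨fun x ↦ ?_, hiso.isMetricAlgebroid htan (isSmoothSubbundle_eigenbundle η b ε), htan,
    eigenbundleEquiv η b ε, fun _ _ ↦ rfl, hiso⟩
  ext u
  exact ⟨fun hu ↦ ⟨u.1, graphVector_fst η b ε hu⟩,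
    fun ⟨v, hv⟩ ↦ hv ▸ graphVector_mem η b ε x v⟩
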